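/- For an input permutation $\pi=\pi_1\cdots\pi_n$ of $\{1,\dots,n\}$ in one-line notation, the stack-sorting map $s$ is the following procedure, which uses one stack: if the stack is empty or the next input entry is smaller than the entry at the top of the stack, then the next input entry is placed on top of the stack; otherwise (in particular, if no input is left) the entry at the top of the stack is removed and appended to the end of the output. The procedure ends when the output has length $n$, and $s(\pi)$ is this output. A permutation $\pi$ is called $3$-stack-sortable if $s(s(s(\pi)))$ is increasing. Let $W_3(n)$ be the number of $3$-stack-sortable permutations of $\{1,\dots,n\}$. Then the limit $\lim_{n\to\infty}W_3(n)^{1/n}$ exists (as a real number) and \[\lim_{n\to\infty}W_3(n)^{1/n}\geq 8.659702.\] -/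

import Mathlib

open Filter Topology

namespace StackSorting

/-- The stack-sorting procedure. The first argument is the remaining input, the second one is the
current content of the stack (top first), and the value is the list of entries that are sent to the
output from now on. If the next input entry is smaller than the top of the stack, or the stack is
empty, then it is pushed onto the stack; otherwise the top of the stack is popped and appended to
the output. -/
def run : List ℕ → List ℕ → List ℕ
  | [], [] => []
  | [], top :: stack => top :: run [] stack
  | next :: input, [] => run input [next]
  | next :: input, top :: stack =>
      if next < top then run input (next :: top :: stack)
      else top :: run (next :: input) stack
  termination_by input stack => 2 * input.length + stack.length

/-- West's stack-sorting map `s`, on words written in one-line notation. -/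
def stackSort (π : List ℕ) : List ℕ := run π []

/-- The set `S_n` of permutations of `{1, …, n}`, written in one-line notation as words that
contain each of `1, …, n` exactly once. -/
def permutationWords (n : ℕ) : Set (List ℕ) := {π | π.Perm (List.range' 1 n)}

/-- `π` is `t`-stack-sortable: the `t`-fold iterate of the stack-sorting map sends it to an
increasing word. -/
def IsStackSortable (t : ℕ) (π : List ℕ) : Prop := (stackSort^[t] π).Pairwise (· < ·)

/-- The number `W_t(n)` of `t`-stack-sortable permutations in `S_n`. -/
noncomputable def W (t n : ℕ) : ℕ := {π ∈ permutationWords n | IsStackSortable t π}.ncard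

end StackSorting

/-! Existence of the limit. Direct sums of 3-stack-sortable permutations are 3-stack-sortable, so `W
3` is supermultiplicative, and the push/pop words of the three runs determine the permutation, so `W
3 n ≤ 64 ^ n`. Fekete's lemma gives a limit `L`, and moreover `W 3 n ≤ L ^ n` for every `n`.

A large subfamily. By s(LnR) = s(L)s(R)n, two permutations can be glued around a new maximum. Only
the two largest entries of the left one are interleaved with the right one: the largest is raised
above the `b` smallest right entries, the second largest above the `e ≤ b` smallest. The result is
again 3-stack-sortable if s(right) is a direct sum at height `b` and s²(right) is one at height `e`
(`IsStackSortable.glue`, `sound_node`). Iterated gluing is encoded by binary trees; distinct valid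
trees give distinct permutations (`perm_inj`). The heights at which s² is known to split are tracked
as `cuts`, flagged when s is known to split too. For counting, only the word of flags matters
(`word_node`).

Divergence. Following left subtrees, the word of a tree is a concatenation of pieces, one for each
gluing. If the total weight of all pieces at `t` is at least 1, the series over sequences of pieces
diverges, hence so does the series over trees (`treeSum_eq_top`). As it is dominated by the sum of
`W 3 n * t ^ n`, it follows that `L ≥ 1 / t`. This is applied with `t = 3 / 26`, and 26/3 >
8.659702.

The numerical inequality `one_le_pieceSum`. The weighted sums satisfy a recursive system of
inequalities with nonnegative terms, so iterating from zero yields lower bounds. The rest of a word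
from a letter `true` on is again a block starting with `true` followed by further blocks, which
closes the system (`blockSum_markSum`). Bounds are polynomials in the word length; truncating and
rounding down only weakens them. Each polynomial is packed into one integer, and 41 rounds are
evaluated. -/

namespace StackSorting

/-! ### The recursion s(LnR) = s(L)s(R)n and direct sums -/

theorem run_push {next top : ℕ} (input stack : List ℕ) (h : next < top) :
    run (next :: input) (top :: stack) = run input (next :: top :: stack) := by
  simp [run, h]

theorem run_pop {next top : ℕ} (input stack : List ℕ) (h : ¬ next < top) :
    run (next :: input) (top :: stack) = top :: run (next :: input) stack := by
  simp [run, h]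

theorem run_cons_nil (next : ℕ) (input : List ℕ) : run (next :: input) [] = run input [next] := by
  simp [run]

theorem run_nil_cons (top : ℕ) (stack : List ℕ) : run [] (top :: stack) = top :: run [] stack := by
  simp [run]

/-- An arriving entry larger than everything before it empties the stack, so the run restarts from
there. -/
theorem run_append_of_lt {n : ℕ} (rest inp st : List ℕ) (h₁ : ∀ x ∈ inp, x < n)
    (h₂ : ∀ x ∈ st, x < n) :
    run (inp ++ n :: rest) st = run inp st ++ run (n :: rest) [] := by
  induction inp, st using run.induct with
  | case1 => simp [run]
  | case2 top stack ih =>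
    have : ¬ n < top := by have := h₂ top (by simp); omega
    rw [List.nil_append, run_pop _ _ this]
    simp only [List.nil_append] at ih
    rw [ih (by simp) (fun x hx => h₂ x (by simp [hx])), run_nil_cons, List.cons_append]
  | case3 next input ih =>
    rw [List.cons_append, run_cons_nil, run_cons_nil next, ih]
    · exact fun x hx => h₁ x (by simp [hx])
    · intro x hx; exact h₁ x (by simp_all)
  | case4 next input top stack h ih =>
    rw [List.cons_append, run_push _ _ h, run_push _ _ h, ih]
    · exact fun x hx => h₁ x (by simp [hx])
    · intro x hx
      rcases List.mem_cons.1 hx with rfl | hx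
      · exact h₁ x (by simp)
      · exact h₂ x hx
  | case5 next input top stack h ih =>
    rw [List.cons_append, run_pop _ _ h, run_pop _ _ h, ← List.cons_append, ih]
    · rfl
    · exact h₁
    · exact fun x hx => h₂ x (by simp [hx])

/-- An entry at the bottom of the stack that exceeds the whole remaining input is never popped
before the input ends, so it leaves last and does not affect the rest. -/
theorem run_bottom {n : ℕ} (inp st : List ℕ) (h : ∀ x ∈ inp, x < n) :
    run inp (st ++ [n]) = run inp st ++ [n] := by
  induction inp, st using run.induct with
  | case1 => simp [run]
  | case2 top stack ih => rw [List.cons_append, run_nil_cons, run_nil_cons, ih h]; rfl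
  | case3 next input ih =>
    have hn : next < n := h next (by simp)
    rw [List.nil_append, run_push _ _ hn, run_cons_nil]
    exact ih (fun x hx => h x (by simp [hx]))
  | case4 next input top stack hlt ih =>
    rw [List.cons_append, run_push _ _ hlt, run_push _ _ hlt]
    exact ih (fun x hx => h x (by simp [hx]))
  | case5 next input top stack hlt ih =>
    rw [List.cons_append, run_pop _ _ hlt, run_pop _ _ hlt, ih h]
    rfl

theorem stackSort_nil : stackSort [] = [] := by simp [stackSort, run]

/-- The recursive description `s(L n R) = s(L) s(R) n`. -/
theorem stackSort_append_cons {n : ℕ} {L R : List ℕ} (hL : ∀ x ∈ L, x < n)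
    (hR : ∀ x ∈ R, x < n) :
    stackSort (L ++ n :: R) = stackSort L ++ stackSort R ++ [n] := by
  unfold stackSort
  rw [run_append_of_lt R L [] hL (by simp), run_cons_nil]
  have := run_bottom R [] hR
  simp only [List.nil_append] at this
  rw [this, List.append_assoc]

theorem stackSort_concat {n : ℕ} {L : List ℕ} (hL : ∀ x ∈ L, x < n) :
    stackSort (L ++ [n]) = stackSort L ++ [n] := by
  rw [stackSort_append_cons hL (by simp)]
  simp [stackSort_nil]

/-- The stack-sorting map is compatible with direct sums. -/
theorem stackSort_append {X Y : List ℕ} (h : ∀ x ∈ X, ∀ y ∈ Y, x < y) :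
    stackSort (X ++ Y) = stackSort X ++ stackSort Y := by
  cases Y with
  | nil => simp [stackSort_nil]
  | cons y Y => exact run_append_of_lt Y X [] (fun x hx => h x hx y (by simp)) (by simp)

theorem run_perm (inp st : List ℕ) : (run inp st).Perm (inp ++ st) := by
  induction inp, st using run.induct with
  | case1 => simp [run]
  | case2 top stack ih => rw [run_nil_cons]; exact ih.cons top
  | case3 next input ih =>
    rw [run_cons_nil]; exact ih.trans (by simp)
  | case4 next input top stack h ih =>
    rw [run_push _ _ h]; exact ih.trans List.perm_middle
  | case5 next input top stack h ih =>
    rw [run_pop _ _ h]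
    exact (ih.cons top).trans List.perm_middle.symm

theorem stackSort_perm (l : List ℕ) : (stackSort l).Perm l := by
  simpa [stackSort] using run_perm l []

theorem mem_stackSort {l : List ℕ} {x : ℕ} : x ∈ stackSort l ↔ x ∈ l :=
  (stackSort_perm l).mem_iff

theorem run_map {f : ℕ → ℕ} (hf : StrictMono f) (inp st : List ℕ) :
    run (inp.map f) (st.map f) = (run inp st).map f := by
  induction inp, st using run.induct with
  | case1 => simp [run]
  | case2 top stack ih => simpa [run] using ih
  | case3 next input ih => simpa [run] using ih
  | case4 next input top stack h ih =>
    simp only [List.map_cons] at ih ⊢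
    rw [run_push _ _ h, run_push _ _ (hf h), ih]
  | case5 next input top stack h ih =>
    simp only [List.map_cons] at ih ⊢
    rw [run_pop _ _ h, run_pop _ _ (by rwa [hf.lt_iff_lt]), ih]
    rfl

theorem stackSort_map {f : ℕ → ℕ} (hf : StrictMono f) (l : List ℕ) :
    stackSort (l.map f) = (stackSort l).map f := by
  simpa [stackSort] using run_map hf l []

theorem stackSort_of_pairwise {l : List ℕ} (h : l.Pairwise (· < ·)) : stackSort l = l := by
  induction l with
  | nil => exact stackSort_nil
  | cons x l ih =>
    rw [List.pairwise_cons] at h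
    have : stackSort ([x] ++ l) = stackSort [x] ++ stackSort l :=
      stackSort_append (by simpa using h.1)
    rw [List.singleton_append] at this
    rw [this, ih h.2]
    simp [stackSort, run]

/-- The stack-sorting map moves the maximum to the end. -/
theorem stackSort_eq_concat {l : List ℕ} {n : ℕ} (h : n ∈ l) (hn : ∀ x ∈ l, x ≤ n)
    (hd : l.Nodup) : ∃ u, stackSort l = u ++ [n] ∧ ∀ x ∈ u, x < n := by
  obtain ⟨L, R, rfl⟩ := List.append_of_mem h
  rw [List.nodup_append] at hd
  have hL : ∀ x ∈ L, x < n := fun x hx =>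
    lt_of_le_of_ne (hn x (by simp [hx])) (hd.2.2 x hx n (by simp))
  have hR : ∀ x ∈ R, x < n := fun x hx =>
    lt_of_le_of_ne (hn x (by simp [hx])) (by
      rintro rfl
      exact (List.nodup_cons.1 hd.2.1).1 hx)
  refine ⟨_, stackSort_append_cons hL hR, ?_⟩
  intro x hx
  simp only [List.mem_append, mem_stackSort] at hx
  exact hx.elim (hL x) (hR x)

end StackSorting

/-! ### Exponential upper bound, supermultiplicativity and Fekete's lemma -/

namespace StackSorting

/-- The push/pop word of the stack-sorting procedure. -/
def runWord : List ℕ → List ℕ → List Bool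
  | [], [] => []
  | [], _ :: stack => false :: runWord [] stack
  | next :: input, [] => true :: runWord input [next]
  | next :: input, top :: stack =>
      if next < top then true :: runWord input (next :: top :: stack)
      else false :: runWord (next :: input) stack
  termination_by input stack => 2 * input.length + stack.length

theorem length_runWord (inp st : List ℕ) :
    (runWord inp st).length = 2 * inp.length + st.length := by
  induction inp, st using run.induct with
  | case1 => simp [runWord]
  | case2 top stack ih => simp [runWord, ih]
  | case3 next input ih => simp [runWord, ih]; omega
  | case4 next input top stack h ih => simp [runWord, ih, h]; omega
  | case5 next input top stack h ih => simp [runWord, ih, h]; omega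

/-- Each step is a push or a pop, and the letter of `runWord` says which. Without the comparison
that caused it, the step can be undone; this is what `run_inj` uses. -/
theorem run_step (inp st : List ℕ) :
    (inp = [] ∧ st = [] ∧ run inp st = [] ∧ runWord inp st = []) ∨
    (∃ x i, inp = x :: i ∧ run inp st = run i (x :: st) ∧
      runWord inp st = true :: runWord i (x :: st)) ∨
    (∃ x s, st = x :: s ∧ run inp st = x :: run inp s ∧
      runWord inp st = false :: runWord inp s) := by
  rcases inp with _ | ⟨x, i⟩ <;> rcases st with _ | ⟨y, s⟩
  · simp [run, runWord]
  · simp [run, runWord]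
  · simp [run, runWord]
  · by_cases h : x < y <;> simp [run, runWord, h]

/-- The output and the push/pop word determine the input and the initial stack. -/
theorem run_inj (w : List Bool) : ∀ inp st inp' st' : List ℕ, runWord inp st = w →
    runWord inp' st' = w → run inp st = run inp' st' → inp = inp' ∧ st = st' := by
  induction w with
  | nil =>
    intro inp st inp' st' h h' _
    have h1 := congrArg List.length h
    have h2 := congrArg List.length h'
    rw [length_runWord] at h1 h2
    simp only [List.length_nil, Nat.add_eq_zero_iff, Nat.mul_eq_zero, List.length_eq_zero_iff] at h1 h2
    simp_all
  | cons b w ih =>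
    intro inp st inp' st' h h' hr
    rcases run_step inp st with ⟨-, -, -, h1⟩ | ⟨x, i, rfl, h1, h2⟩ | ⟨x, s, rfl, h1, h2⟩
    · simp [h1] at h
    · rcases run_step inp' st' with ⟨-, -, -, h3⟩ | ⟨x', i', rfl, h3, h4⟩ | ⟨x', s', rfl, h3, h4⟩
      · simp [h3] at h'
      · rw [h2] at h; rw [h4] at h'; rw [h1, h3] at hr
        obtain ⟨rfl, e⟩ := ih _ _ _ _ (List.cons.inj h).2 (List.cons.inj h').2 hr
        simp only [List.cons.injEq] at e
        simp [e.1, e.2]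
      · rw [h2] at h; rw [h4] at h'
        have e1 := (List.cons.inj h).1
        have e2 := (List.cons.inj h').1
        simp [← e1] at e2
    · rcases run_step inp' st' with ⟨-, -, -, h3⟩ | ⟨x', i', rfl, h3, h4⟩ | ⟨x', s', rfl, h3, h4⟩
      · simp [h3] at h'
      · rw [h2] at h; rw [h4] at h'
        have e1 := (List.cons.inj h).1
        have e2 := (List.cons.inj h').1
        simp [← e1] at e2
      · rw [h2] at h; rw [h4] at h'; rw [h1, h3] at hr
        obtain ⟨rfl, rfl⟩ := ih _ _ _ _ (List.cons.inj h).2 (List.cons.inj h').2 (List.cons.inj hr).2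
        simp [(List.cons.inj hr).1]

theorem stackSort_inj {π σ : List ℕ} (h : runWord π [] = runWord σ [])
    (hs : stackSort π = stackSort σ) : π = σ :=
  (run_inj _ π [] σ [] h rfl hs).1

theorem iterate_stackSort_perm (t : ℕ) (l : List ℕ) : (stackSort^[t] l).Perm l := by
  induction t with
  | zero => exact List.Perm.refl l
  | succ t ih => rw [Function.iterate_succ_apply']; exact (stackSort_perm _).trans ih

theorem finite_permutationWords (n : ℕ) : (permutationWords n).Finite := by
  refine (List.finite_toSet (List.range' 1 n).permutations).subset ?_
  intro π hπ
  simpa [permutationWords] using hπ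

theorem finite_sortable (t n : ℕ) : {π ∈ permutationWords n | IsStackSortable t π}.Finite :=
  (finite_permutationWords n).subset (Set.sep_subset _ _)

theorem iterate_eq_range' {t n : ℕ} {π : List ℕ} (h : π ∈ permutationWords n)
    (ht : IsStackSortable t π) : stackSort^[t] π = List.range' 1 n := by
  refine List.Perm.eq_of_pairwise ?_ ht List.pairwise_lt_range' ((iterate_stackSort_perm t π).trans h)
  intro a b _ _ h1 h2
  omega

/-- The last output is the increasing word, so the three push/pop words, each of length `2 * n`,
determine the input. There are `4 ^ n` candidates for each of them. -/
theorem W_three_le (n : ℕ) : W 3 n ≤ 64 ^ n := by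
  let V := {l : List Bool // l.length = 2 * n}
  have hlen : ∀ π ∈ permutationWords n, (runWord π []).length = 2 * n := by
    intro π hπ
    rw [length_runWord, List.Perm.length_eq hπ]; simp
  have hs : ∀ π ∈ permutationWords n, stackSort π ∈ permutationWords n :=
    fun π hπ => (stackSort_perm π).trans hπ
  let A := {π ∈ permutationWords n | IsStackSortable 3 π}
  let F : A → V × V × V := fun π =>
    (⟨_, hlen _ π.2.1⟩, ⟨_, hlen _ (hs _ π.2.1)⟩, ⟨_, hlen _ (hs _ (hs _ π.2.1))⟩)
  have hF : Function.Injective F := by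
    rintro ⟨π, hπ, h⟩ ⟨σ, hσ, h'⟩ e
    simp only [F, Prod.mk.injEq] at e
    have e3 : stackSort^[3] π = stackSort^[3] σ := by
      rw [iterate_eq_range' hπ h, iterate_eq_range' hσ h']
    have : π = σ := stackSort_inj (congrArg Subtype.val e.1)
      (stackSort_inj (congrArg Subtype.val e.2.1) (stackSort_inj (congrArg Subtype.val e.2.2) e3))
    simp [this]
  have hV : Nat.card V = 2 ^ (2 * n) := by
    have : Nat.card V = Fintype.card (List.Vector Bool (2 * n)) := by
      rw [← Nat.card_eq_fintype_card]; rfl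
    rw [this, card_vector]; simp
  have : Finite V := inferInstanceAs (Finite (List.Vector Bool (2 * n)))
  calc W 3 n = Nat.card A := (Nat.card_coe_set_eq A).symm
    _ ≤ Nat.card (V × V × V) := Nat.card_le_card_of_injective F hF
    _ = 64 ^ n := by
      rw [Nat.card_prod, Nat.card_prod, hV, ← pow_add, ← pow_add,
        show 2 * n + (2 * n + 2 * n) = 6 * n by ring, pow_mul]
      norm_num

theorem iterate_stackSort_append (t : ℕ) {X Y : List ℕ} (h : ∀ x ∈ X, ∀ y ∈ Y, x < y) :
    stackSort^[t] (X ++ Y) = stackSort^[t] X ++ stackSort^[t] Y := by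
  induction t with
  | zero => rfl
  | succ t ih =>
    rw [Function.iterate_succ_apply', ih, stackSort_append, Function.iterate_succ_apply',
      Function.iterate_succ_apply']
    intro x hx y hy
    exact h x ((iterate_stackSort_perm t X).mem_iff.1 hx) y ((iterate_stackSort_perm t Y).mem_iff.1 hy)

theorem iterate_stackSort_map (t : ℕ) {f : ℕ → ℕ} (hf : StrictMono f) (l : List ℕ) :
    stackSort^[t] (l.map f) = (stackSort^[t] l).map f := by
  induction t with
  | zero => rfl
  | succ t ih =>
    rw [Function.iterate_succ_apply', ih, stackSort_map hf, Function.iterate_succ_apply']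

theorem mem_permutationWords_bounds {n x : ℕ} {π : List ℕ} (h : π ∈ permutationWords n) :
    x ∈ π ↔ 1 ≤ x ∧ x ≤ n := by
  rw [List.Perm.mem_iff h, List.mem_range'_1]; omega

/-- The direct sum is the injection: the stack-sorting map acts on both summands separately. -/
theorem W_mul_le (t m n : ℕ) : W t m * W t n ≤ W t (m + n) := by
  unfold W
  rw [← Set.ncard_prod]
  refine Set.ncard_le_ncard_of_injOn (fun p : List ℕ × List ℕ => p.1 ++ p.2.map (m + ·)) ?_ ?_
    (finite_sortable t (m + n))
  · rintro ⟨π, σ⟩ ⟨⟨hπ, h1⟩, ⟨hσ, h2⟩⟩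
    have hf : StrictMono (m + · : ℕ → ℕ) := fun a b h => by simpa using h
    have hlt : ∀ x ∈ π, ∀ y ∈ σ.map (m + ·), x < y := by
      intro x hx y hy
      obtain ⟨z, hz, rfl⟩ := List.mem_map.1 hy
      have h3 := (mem_permutationWords_bounds hπ).1 hx
      have h4 := (mem_permutationWords_bounds hσ).1 hz
      omega
    refine ⟨?_, ?_⟩
    · change (π ++ σ.map (m + ·)).Perm _
      rw [List.range'_append_1.symm]
      refine hπ.append ?_
      have := List.Perm.map (m + ·) hσ
      rw [List.map_add_range'] at this
      rwa [add_comm 1 m]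
    · change ((stackSort^[t]) _).Pairwise _
      rw [iterate_stackSort_append t hlt, iterate_stackSort_map t hf, List.pairwise_append]
      refine ⟨h1, List.Pairwise.map _ (fun a b h => hf h) h2, ?_⟩
      intro x hx y hy
      refine hlt x ((iterate_stackSort_perm t π).mem_iff.1 hx) y ?_
      exact ((iterate_stackSort_perm t σ).map _).mem_iff.1 hy
  · rintro ⟨π, σ⟩ ⟨⟨hπ, -⟩, -⟩ ⟨π', σ'⟩ ⟨⟨hπ', -⟩, -⟩ e
    have hl : π.length = π'.length := by
      rw [List.Perm.length_eq hπ, List.Perm.length_eq hπ']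
    obtain ⟨rfl, e2⟩ := List.append_inj e hl
    have hf : Function.Injective (m + · : ℕ → ℕ) := fun a b h => by simpa using h
    exact Prod.ext rfl (hf.list_map e2)

theorem W_pos (t n : ℕ) : 0 < W t n := by
  unfold W
  rw [Set.ncard_pos (finite_sortable t n)]
  refine ⟨List.range' 1 n, List.Perm.refl _, ?_⟩
  unfold IsStackSortable
  have h : stackSort^[t] (List.range' 1 n) = List.range' 1 n :=
    Function.iterate_fixed (stackSort_of_pairwise List.pairwise_lt_range') t
  rw [h]; exact List.pairwise_lt_range'

/-- Fekete's lemma for the numbers of `3`-stack-sortable permutations. -/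
theorem exists_growth_rate : ∃ L : ℝ, 0 < L ∧
    Tendsto (fun n : ℕ => (W 3 n : ℝ) ^ (1 / (n : ℝ))) atTop (𝓝 L) ∧
    ∀ n, (W 3 n : ℝ) ≤ L ^ n := by
  have hpos : ∀ n, (0 : ℝ) < W 3 n := fun n => by exact_mod_cast W_pos 3 n
  -- The sign turns supermultiplicativity into subadditivity.
  let u : ℕ → ℝ := fun n => - Real.log (W 3 n)
  have hu : Subadditive u := by
    intro m n
    have h : ((W 3 m : ℝ) * W 3 n) ≤ W 3 (m + n) := by exact_mod_cast W_mul_le 3 m n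
    have := Real.log_le_log (mul_pos (hpos m) (hpos n)) h
    rw [Real.log_mul (hpos m).ne' (hpos n).ne'] at this
    simp only [u]; linarith
  have hb : BddBelow (Set.range fun n => u n / n) := by
    refine ⟨- Real.log 64, ?_⟩
    rintro _ ⟨n, rfl⟩
    rcases Nat.eq_zero_or_pos n with rfl | hn
    · simp; exact Real.log_nonneg (by norm_num)
    · have hn' : (0 : ℝ) < n := by exact_mod_cast hn
      simp only [u]
      rw [le_div_iff₀ hn']
      have h : (W 3 n : ℝ) ≤ 64 ^ n := by exact_mod_cast W_three_le n
      have := Real.log_le_log (hpos n) h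
      rw [Real.log_pow] at this
      linarith
  refine ⟨Real.exp (- hu.lim), Real.exp_pos _, ?_, ?_⟩
  · have h := (Real.continuous_exp.tendsto _).comp (hu.tendsto_lim hb).neg
    refine h.congr fun n => ?_
    simp only [Function.comp, u]
    rw [Real.rpow_def_of_pos (hpos n)]
    congr 1; ring
  · intro n
    rcases Nat.eq_zero_or_pos n with rfl | hn
    · have h : (W 3 0 : ℝ) ≤ 64 ^ 0 := by exact_mod_cast W_three_le 0
      simpa using h
    -- The Fekete limit is an infimum, so it bounds each single term; this gives `W 3 n ≤ L ^ n`.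
    · have h := hu.lim_le_div hb hn.ne'
      have hn' : (0 : ℝ) < n := by exact_mod_cast hn
      rw [le_div_iff₀ hn'] at h
      simp only [u] at h
      rw [← Real.exp_nat_mul]
      rw [← Real.log_le_iff_le_exp (hpos n)]
      linarith

end StackSorting

/-! ### Direct-sum positions and the gluing of two words -/

namespace StackSorting

/-- `w` is a concatenation of a word with entries at most `k` and one with entries above `k`. -/
def Split (w : List ℕ) (k : ℕ) : Prop := w.Pairwise fun x y => y ≤ k → x ≤ k

theorem Split.append_low {u v : List ℕ} {k : ℕ} (hu : ∀ x ∈ u, x ≤ k) (hv : Split v k) :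
    Split (u ++ v) k := by
  refine List.pairwise_append.2 ⟨?_, hv, fun x hx _ _ _ => hu x hx⟩
  exact List.pairwise_of_forall_mem_list fun x hx _ _ _ => hu x hx

theorem Split.append_high {u v : List ℕ} {k : ℕ} (hu : Split u k) (hv : ∀ y ∈ v, k < y) :
    Split (u ++ v) k := by
  refine List.pairwise_append.2 ⟨hu, ?_, fun x _ y hy h => absurd (hv y hy) (by omega)⟩
  exact List.pairwise_of_forall_mem_list fun x _ y hy h => absurd (hv y hy) (by omega)

theorem Split.left {u v : List ℕ} {k : ℕ} (h : Split (u ++ v) k) : Split u k :=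
  (List.pairwise_append.1 h).1

theorem Split.right {u v : List ℕ} {k : ℕ} (h : Split (u ++ v) k) : Split v k :=
  (List.pairwise_append.1 h).2.1

theorem Split.map {w : List ℕ} {k k' : ℕ} {f : ℕ → ℕ} (h : Split w k)
    (hf : ∀ x ∈ w, (f x ≤ k' ↔ x ≤ k)) : Split (w.map f) k' := by
  unfold Split
  rw [List.pairwise_map]
  refine List.Pairwise.imp_of_mem ?_ h
  intro a b ha hb hab hk
  exact (hf a ha).2 (hab ((hf b hb).1 hk))

theorem Split.of_high {v : List ℕ} {k : ℕ} (hv : ∀ y ∈ v, k < y) : Split v k := by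
  simpa using Split.append_high (u := []) List.Pairwise.nil hv

theorem Split.of_low {v : List ℕ} {k : ℕ} (hv : ∀ y ∈ v, y ≤ k) : Split v k := by
  simpa using Split.append_low (v := []) hv List.Pairwise.nil

theorem Split.exists_append {w : List ℕ} {k : ℕ} (h : Split w k) :
    ∃ u v, w = u ++ v ∧ (∀ x ∈ u, x ≤ k) ∧ ∀ y ∈ v, k < y := by
  induction w with
  | nil => exact ⟨[], [], by simp⟩
  | cons x w ih =>
    obtain ⟨h1, h2⟩ := List.pairwise_cons.1 h
    by_cases hx : x ≤ k
    · obtain ⟨u, v, rfl, hu, hv⟩ := ih h2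
      exact ⟨x :: u, v, rfl, by simpa using ⟨hx, hu⟩, hv⟩
    · refine ⟨[], x :: w, rfl, by simp, ?_⟩
      intro y hy
      rcases List.mem_cons.1 hy with rfl | hy
      · omega
      · by_contra hk
        exact hx (h1 y hy (by omega))

/-- Relabelling of the entries to the left of the maximum: the two largest entries are raised. -/
def raiseTop (A e b x : ℕ) : ℕ := if x + 2 ≤ A then x else if x + 1 = A then x + e else x + b

/-- Relabelling of the entries to the right of the maximum. -/
def makeRoom (A e b y : ℕ) : ℕ := if y ≤ e then y + A - 2 else if y ≤ b then y + A - 1 else y + A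

theorem raiseTop_strictMono {A e b : ℕ} (h : e ≤ b) : StrictMono (raiseTop A e b) := by
  intro x y hxy
  unfold raiseTop
  split_ifs <;> omega

theorem makeRoom_strictMono {A e b : ℕ} (hA : 1 ≤ A) (h : e = 0 ∨ 2 ≤ A) :
    StrictMono (makeRoom A e b) := by
  intro x y hxy
  unfold makeRoom
  split_ifs <;> omega

/-- A split of the left word at height at most `A - 2` survives: relabelling fixes the entries up to
there, and everything else ends up above. -/
theorem split_glue_lower {A e b : ℕ} {X rest : List ℕ} {k : ℕ} (hk : k + 2 ≤ A) (hX : Split (X ++ [A]) k)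
    (hX' : ∀ x ∈ X, x < A) (hrest : ∀ y ∈ rest, A ≤ y + 1) :
    Split (X.map (raiseTop A e b) ++ rest) k := by
  refine Split.append_high (hX.left.map ?_) fun y hy => by have := hrest y hy; omega
  intro x hx
  have := hX' x hx
  unfold raiseTop
  split_ifs <;> omega

/-- Between the heights `e` and `b`, the raised second largest left entry is below the split and the
raised largest one above it. Hence the splits of the right word are shifted by `A - 1`. -/
theorem split_glue_middle {A B e b : ℕ} (hA : 1 ≤ A) (hb : b ≤ B)
    {X Y Z : List ℕ} {k : ℕ} (hek : e ≤ k) (hkb : k ≤ b)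
    (hYZ : Split (Y ++ Z) k) (hX : ∀ x ∈ X, x < A) (hY : ∀ x ∈ Y, 1 ≤ x ∧ x ≤ b)
    (hZ : ∀ x ∈ Z, b < x) :
    Split (X.map (raiseTop A e b) ++ (Y.map (makeRoom A e b) ++ ([A + b] ++
      (Z.map (makeRoom A e b) ++ [A + B + 1])))) (A - 1 + k) := by
  refine Split.append_low ?_ (Split.append_high (hYZ.left.map ?_) ?_)
  · intro x hx
    obtain ⟨x, hz, rfl⟩ := List.mem_map.1 hx
    have := hX x hz
    unfold raiseTop; split_ifs <;> omega
  · intro x hx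
    have := hY x hx
    unfold makeRoom; split_ifs <;> omega
  · intro x hx
    simp only [List.mem_append, List.mem_singleton, List.mem_map] at hx
    rcases hx with rfl | ⟨x, hx, rfl⟩ | rfl
    · omega
    · have := hZ x hx
      unfold makeRoom; split_ifs <;> omega
    · omega

/-- From height `b` on, the whole left word is below the split, so the shift is by `A`. The height
`b` itself thus occurs both here and in `split_glue_middle`. -/
theorem split_glue_upper {A B e b : ℕ} (he : e ≤ b) {u Z : List ℕ} {k : ℕ} (hbk : b ≤ k) (hkB : k ≤ B)
    (hZ : Split Z k) (hu : ∀ x ∈ u, x ≤ A + b) (hZ' : ∀ x ∈ Z, b < x) :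
    Split (u ++ (Z.map (makeRoom A e b) ++ [A + B + 1])) (k + A) := by
  refine Split.append_low (fun x hx => by have := hu x hx; omega)
    (Split.append_high (hZ.map ?_) ?_)
  · intro x hx
    have := hZ' x hx
    unfold makeRoom; split_ifs <;> omega
  · intro x hx
    rw [List.mem_singleton] at hx
    omega

/-- The image of the glued word under the stack-sorting map. -/
theorem stackSort_glue {A B e b : ℕ} (hA : 1 ≤ A) (he : e ≤ b) (hb : b ≤ B)
    (heA : e = 0 ∨ 2 ≤ A) {L R ta β₁ β₂ : List ℕ} (hL : stackSort L = ta ++ [A])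
    (hR : stackSort R = β₁ ++ β₂) (hL' : ∀ x ∈ L, x ≤ A) (hR' : ∀ x ∈ R, x ≤ B) :
    stackSort (L.map (raiseTop A e b) ++ (A + B + 1) :: R.map (makeRoom A e b)) =
      ta.map (raiseTop A e b) ++ ([A + b] ++ (β₁.map (makeRoom A e b) ++
        (β₂.map (makeRoom A e b) ++ [A + B + 1]))) := by
  rw [stackSort_append_cons, stackSort_map (raiseTop_strictMono he),
    stackSort_map (makeRoom_strictMono hA heA), hL, hR]
  · have : raiseTop A e b A = A + b := by unfold raiseTop; split_ifs <;> omega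
    simp [this]
  · intro x hx
    obtain ⟨x, hz, rfl⟩ := List.mem_map.1 hx
    have := hL' x hz
    unfold raiseTop; split_ifs <;> omega
  · intro x hx
    obtain ⟨x, hz, rfl⟩ := List.mem_map.1 hx
    have := hR' x hz
    unfold makeRoom; split_ifs <;> omega

/-- After one pass the word is the direct sum of a part with maximum `A + b` and a part formed by
`β₂` and the overall maximum. The second pass moves `A + b` behind `β₁`. -/
theorem stackSort_stackSort_glue {A B e b : ℕ} (hA : 1 ≤ A) (he : e ≤ b) (hb : b ≤ B)
    (heA : e = 0 ∨ 2 ≤ A) {ta β₁ β₂ : List ℕ} (hta : ∀ x ∈ ta, x < A)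
    (h₁ : ∀ x ∈ β₁, x ≤ b) (h₂ : ∀ x ∈ β₂, b < x ∧ x ≤ B) :
    stackSort (ta.map (raiseTop A e b) ++ ([A + b] ++ (β₁.map (makeRoom A e b) ++
        (β₂.map (makeRoom A e b) ++ [A + B + 1])))) =
      (stackSort ta).map (raiseTop A e b) ++ ((stackSort β₁).map (makeRoom A e b) ++ ([A + b] ++
        ((stackSort β₂).map (makeRoom A e b) ++ [A + B + 1]))) := by
  have e1 : ∀ x ∈ ta.map (raiseTop A e b), x < A + b := by
    intro x hx
    obtain ⟨x, hz, rfl⟩ := List.mem_map.1 hx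
    have := hta x hz
    unfold raiseTop; split_ifs <;> omega
  have e2 : ∀ x ∈ β₁.map (makeRoom A e b), x < A + b := by
    intro x hx
    obtain ⟨x, hz, rfl⟩ := List.mem_map.1 hx
    have := h₁ x hz
    unfold makeRoom; split_ifs <;> omega
  have e3 : ∀ x ∈ β₂.map (makeRoom A e b), A + b < x ∧ x < A + B + 1 := by
    intro x hx
    obtain ⟨x, hz, rfl⟩ := List.mem_map.1 hx
    have := h₂ x hz
    unfold makeRoom; split_ifs <;> omega
  have hlow : ∀ x ∈ ta.map (raiseTop A e b) ++ (A + b) :: β₁.map (makeRoom A e b), x ≤ A + b := by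
    intro x hx
    simp only [List.mem_append, List.mem_cons] at hx
    rcases hx with hx | rfl | hx
    · exact (e1 x hx).le
    · exact le_rfl
    · exact (e2 x hx).le
  have := stackSort_append (X := ta.map (raiseTop A e b) ++ (A + b) :: β₁.map (makeRoom A e b))
    (Y := β₂.map (makeRoom A e b) ++ [A + B + 1]) (by
      intro x hx y hy
      have h3 := hlow x hx
      simp only [List.mem_append, List.mem_singleton] at hy
      rcases hy with hy | rfl
      · have := e3 y hy; omega
      · omega)
  simp only [List.append_assoc, List.cons_append, List.nil_append] at this ⊢
  rw [this, stackSort_append_cons e1 e2, stackSort_concat (fun x hx => (e3 x hx).2),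
    stackSort_map (raiseTop_strictMono he), stackSort_map (makeRoom_strictMono hA heA),
    stackSort_map (makeRoom_strictMono hA heA)]
  simp

end StackSorting

/-! ### Sortability of the glued word; gluing trees and their cuts -/

namespace StackSorting

theorem IsStackSortable.sum {u v : List ℕ} (hu : IsStackSortable 1 u) (hv : IsStackSortable 1 v)
    (h : ∀ x ∈ u, ∀ y ∈ v, x < y) : IsStackSortable 1 (u ++ v) := by
  change (stackSort (u ++ v)).Pairwise _
  rw [stackSort_append h, List.pairwise_append]
  exact ⟨hu, hv, fun x hx y hy => h x (mem_stackSort.1 hx) y (mem_stackSort.1 hy)⟩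

theorem IsStackSortable.of_sum {u v : List ℕ} (huv : IsStackSortable 1 (u ++ v))
    (h : ∀ x ∈ u, ∀ y ∈ v, x < y) : IsStackSortable 1 u ∧ IsStackSortable 1 v := by
  change (stackSort (u ++ v)).Pairwise _ at huv
  rw [stackSort_append h, List.pairwise_append] at huv
  exact ⟨huv.1, huv.2.1⟩

theorem IsStackSortable.map {u : List ℕ} {f : ℕ → ℕ} (hu : IsStackSortable 1 u)
    (hf : StrictMono f) : IsStackSortable 1 (u.map f) := by
  change (stackSort (u.map f)).Pairwise _
  rw [stackSort_map hf, List.pairwise_map]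
  exact List.Pairwise.imp (fun h => hf h) hu

theorem IsStackSortable.cons {u : List ℕ} {n : ℕ} (hu : IsStackSortable 1 u)
    (h : ∀ x ∈ u, x < n) : IsStackSortable 1 (n :: u) := by
  change (stackSort ([] ++ n :: u)).Pairwise _
  rw [stackSort_append_cons (by simp) h, stackSort_nil, List.nil_append, List.pairwise_append]
  refine ⟨hu, by simp, ?_⟩
  intro x hx y hy
  rw [List.mem_singleton] at hy
  exact hy ▸ h x (mem_stackSort.1 hx)

theorem isStackSortable_nil : IsStackSortable 1 [] := by
  change (stackSort []).Pairwise _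
  rw [stackSort_nil]; exact List.Pairwise.nil

/-- This is the third pass. If `X` ends with `A - 1`, that entry becomes `A - 1 + e` and exceeds
exactly the low part `Y₁` of `Y`, so the word is the direct sum of the rest of `X`, of `A - 1 + e`
followed by `Y₁`, of `Y₂`, of `A + b`, of `Z` and of the maximum. A maximum in front of a
1-stack-sortable word does no harm. If `X` is empty, the entry `A - 1 + e` is missing. -/
theorem IsStackSortable.glue {A B e b : ℕ} (hA : 1 ≤ A) (he : e ≤ b) (hb : b ≤ B)
    (heA : e = 0 ∨ 2 ≤ A) {X Y Z : List ℕ}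
    (hX : (2 ≤ A ∧ ∃ ρ, X = ρ ++ [A - 1] ∧ ∀ x ∈ ρ, x < A - 1) ∨ X = [])
    (hXA : ∀ x ∈ X, x < A) (hsX : IsStackSortable 1 (X ++ [A]))
    (hY : ∀ x ∈ Y, 1 ≤ x ∧ x ≤ b) (hZ : ∀ x ∈ Z, b < x ∧ x ≤ B)
    (hYZ : IsStackSortable 1 (Y ++ Z)) (hYe : Split (Y ++ Z) e) :
    IsStackSortable 1 (X.map (raiseTop A e b) ++ (Y.map (makeRoom A e b) ++ ([A + b] ++
      (Z.map (makeRoom A e b) ++ [A + B + 1])))) := by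
  have hf : StrictMono (raiseTop A e b) := raiseTop_strictMono he
  have hg : StrictMono (makeRoom A e b) := makeRoom_strictMono hA heA
  have one : ∀ n, IsStackSortable 1 [n] := fun n => isStackSortable_nil.cons (by simp)
  obtain ⟨sY, sZ⟩ := hYZ.of_sum fun x hx y hy => by
    have := hY x hx; have := hZ y hy; omega
  obtain ⟨Y₁, Y₂, rfl, h1, h2⟩ := hYe.left.exists_append
  obtain ⟨sY₁, sY₂⟩ := sY.of_sum fun x hx y hy => by
    have := h1 x hx; have := h2 y hy; omega
  have hgY₁ : ∀ y ∈ Y₁.map (makeRoom A e b), A ≤ y + 1 ∧ y + 1 < A + e := by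
    intro y hy
    obtain ⟨y, hy', rfl⟩ := List.mem_map.1 hy
    have := h1 y hy'
    have := hY y (by simp [hy'])
    unfold makeRoom; split_ifs; omega
  have hgY₂ : ∀ y ∈ Y₂.map (makeRoom A e b), A + e ≤ y ∧ y < A + b := by
    intro y hy
    obtain ⟨y, hy', rfl⟩ := List.mem_map.1 hy
    have := h2 y hy'
    have := hY y (by simp [hy'])
    unfold makeRoom; split_ifs <;> omega
  have hgZ : ∀ y ∈ Z.map (makeRoom A e b), A + b < y ∧ y < A + B + 1 := by
    intro y hy
    obtain ⟨y, hy', rfl⟩ := List.mem_map.1 hy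
    have := hZ y hy'
    unfold makeRoom; split_ifs <;> omega
  have upper : IsStackSortable 1 (Y₂.map (makeRoom A e b) ++ ([A + b] ++
      (Z.map (makeRoom A e b) ++ [A + B + 1]))) := by
    refine (sY₂.map hg).sum ((one _).sum ((sZ.map hg).sum (one _) ?_) ?_) ?_
    · intro x hx y hy
      rw [List.mem_singleton] at hy
      exact hy ▸ (hgZ x hx).2
    · intro x hx y hy
      rw [List.mem_singleton] at hx
      simp only [List.mem_append, List.mem_singleton] at hy
      rcases hy with hy | rfl
      · have := hgZ y hy; omega
      · omega
    · intro x hx y hy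
      have := hgY₂ x hx
      simp only [List.mem_append, List.mem_singleton] at hy
      rcases hy with rfl | hy | rfl
      · omega
      · have := hgZ y hy; omega
      · omega
  have hupper : ∀ y ∈ Y₂.map (makeRoom A e b) ++ ([A + b] ++
      (Z.map (makeRoom A e b) ++ [A + B + 1])), A + e ≤ y := by
    intro y hy
    simp only [List.mem_append, List.mem_singleton] at hy
    rcases hy with hy | rfl | hy | rfl
    · exact (hgY₂ y hy).1
    · omega
    · have := hgZ y hy; omega
    · omega
  rcases hX with ⟨hA2, ρ, rfl, hρ⟩ | rfl
  · have sρ : IsStackSortable 1 ρ := by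
      refine ((hsX.of_sum ?_).1.of_sum ?_).1
      · intro x hx y hy
        rw [List.mem_singleton] at hy
        exact hy ▸ hXA x hx
      · intro x hx y hy
        rw [List.mem_singleton] at hy
        exact hy ▸ hρ x hx
    have hfρ : ∀ x ∈ ρ.map (raiseTop A e b), x + 2 ≤ A := by
      intro x hx
      obtain ⟨x, hx', rfl⟩ := List.mem_map.1 hx
      have := hρ x hx'
      unfold raiseTop; split_ifs <;> omega
    have ha : raiseTop A e b (A - 1) = A - 1 + e := by unfold raiseTop; split_ifs <;> omega
    have main := (sρ.map hf).sum (((sY₁.map hg).cons (n := A - 1 + e) (by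
        intro x hx
        have := hgY₁ x hx; omega)).sum upper (by
          intro x hx y hy
          have := hupper y hy
          rcases List.mem_cons.1 hx with rfl | hx
          · omega
          · have := hgY₁ x hx; omega)) (by
      intro x hx y hy
      have := hfρ x hx
      simp only [List.cons_append, List.mem_cons] at hy
      rcases hy with rfl | hy
      · omega
      · rcases List.mem_append.1 hy with hy | hy
        · have := hgY₁ y hy; omega
        · have := hupper y hy; omega)
    simpa [ha] using main
  · have main := (sY₁.map hg).sum upper (by
      intro x hx y hy
      have := hupper y hy
      have := hgY₁ x hx; omega)
    simpa using main

/-- Binary trees that describe a family of `3`-stack-sortable permutations. A node without left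
subtree is `single b`; in `node a b j l` the numbers `j` and `l` describe the relative order of the
entries of the two subtrees. -/
inductive GluingTree : Type
  | nil : GluingTree
  | single (b : GluingTree) : GluingTree
  | node (a b : GluingTree) (j l : ℕ) : GluingTree

namespace GluingTree

/-- The number of nodes. -/
def size : GluingTree → ℕ
  | nil => 0
  | single b => size b + 1
  | node a b _ _ => size a + size b + 1

/-- Pairs of numbers whose first entry carries the flag `f` and whose other entries carry the flag
`false`. -/
def flagHead (f : Bool) : List ℕ → List (Bool × ℕ)
  | [] => []
  | k :: ks => (f, k) :: ks.map fun i => (false, i)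

/-- The cuts of a list followed by `n`. -/
def positions (c : List (Bool × ℕ)) (n : ℕ) : List ℕ := c.map Prod.snd ++ [n]

/-- The positions at which the image of the permutation under `s²` is a direct sum. The flag `true`
indicates that the image under `s` is a direct sum at this position, too. -/
def cuts : GluingTree → List (Bool × ℕ)
  | nil => []
  | single b => cuts b ++ [(true, size b)]
  | node a b j l => (cuts a).dropLast ++
      (flagHead (l == 0) ((((positions (cuts b) (size b)).take (j + 1)).drop l).map
        fun k => size a - 1 + k) ++
      (((cuts b).drop j).map (fun c => (c.1, c.2 + size a)) ++ [(true, size a + size b)]))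

/-- The position that belongs to the `j`-th cut. -/
def pos (b : GluingTree) (j : ℕ) : ℕ := (positions (cuts b) (size b)).getD j 0

/-- The permutation that a tree describes. -/
def perm : GluingTree → List ℕ
  | nil => []
  | single b => (size b + 1) :: perm b
  | node a b j l => (perm a).map (raiseTop (size a) (pos b l) (pos b j)) ++
      (size a + size b + 1) :: (perm b).map (makeRoom (size a) (pos b l) (pos b j))

/-- The flags of the cuts. -/
def word (x : GluingTree) : List Bool := (cuts x).map Prod.fst

end GluingTree

/-- The `j`-th letter of the word is `true`, or `j` is the length of the word. -/
def IsMark : List Bool → ℕ → Prop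
  | [], 0 => True
  | [], _ + 1 => False
  | b :: _, 0 => b = true
  | _ :: w, j + 1 => IsMark w j

theorem IsMark.le {w : List Bool} {j : ℕ} (h : IsMark w j) : j ≤ w.length := by
  induction w generalizing j with
  | nil => cases j with
    | zero => simp
    | succ j => exact h.elim
  | cons b w ih => cases j with
    | zero => simp
    | succ j => simpa using ih h

theorem IsMark.getElem {w : List Bool} {j : ℕ} (h : IsMark w j) (hj : j < w.length) :
    w[j] = true := by
  induction w generalizing j with
  | nil => simp at hj
  | cons b w ih => cases j with
    | zero => exact h
    | succ j => exact ih h (by simpa using hj)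

namespace GluingTree

/-- The conditions under which a tree describes a `3`-stack-sortable permutation. -/
def Valid : GluingTree → Prop
  | nil => True
  | single b => Valid b
  | node a b j l => Valid a ∧ a ≠ nil ∧ Valid b ∧ IsMark (word b) j ∧ l ≤ j ∧
      (l = 0 ∨ 2 ≤ size a)

/-- The properties of the permutation and the cuts of a valid tree. -/
structure Sound (x : GluingTree) : Prop where
  perm : x.perm ∈ permutationWords x.size
  sortable : IsStackSortable 3 x.perm
  split : ∀ c ∈ x.cuts, Split (stackSort (stackSort x.perm)) c.2
  split_of_flag : ∀ c ∈ x.cuts, c.1 = true → Split (stackSort x.perm) c.2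
  sorted : (positions x.cuts x.size).Pairwise (· < ·)
  zero : ∃ t, positions x.cuts x.size = 0 :: t
  last : x ≠ nil → ∃ i, x.cuts = i ++ [(true, x.size - 1)]

theorem flagHead_snd (f : Bool) (l : List ℕ) : (flagHead f l).map Prod.snd = l := by
  cases l <;> simp [flagHead, Function.comp_def]

theorem mem_flagHead {f : Bool} {l : List ℕ} {c : Bool × ℕ} (h : c ∈ flagHead f l) :
    c.2 ∈ l ∧ (c.1 = true → f = true ∧ l.head? = some c.2) := by
  cases l with
  | nil => simp [flagHead] at h
  | cons k ks =>
    simp only [flagHead, List.mem_cons, List.mem_map] at h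
    rcases h with rfl | ⟨i, hi, rfl⟩
    · simp
    · simp [hi]

theorem le_of_mem_drop {p : List ℕ} (hp : p.Pairwise (· < ·)) {j x : ℕ} (hx : x ∈ p.drop j) :
    p.getD j 0 ≤ x := by
  obtain ⟨i, hi, rfl⟩ := List.mem_iff_getElem.1 hx
  rw [List.length_drop] at hi
  rw [List.getElem_drop, List.getD_eq_getElem _ _ (by omega)]
  rcases Nat.eq_zero_or_pos i with rfl | h
  · simp
  · exact (List.pairwise_iff_getElem.1 hp j (j + i) (by omega) (by omega) (by omega)).le

theorem le_of_mem_take {p : List ℕ} (hp : p.Pairwise (· < ·)) {j x : ℕ} (hj : j < p.length)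
    (hx : x ∈ p.take (j + 1)) : x ≤ p.getD j 0 := by
  obtain ⟨i, hi, rfl⟩ := List.mem_iff_getElem.1 hx
  rw [List.length_take] at hi
  rw [List.getElem_take, List.getD_eq_getElem _ _ hj]
  rcases Nat.lt_or_ge i j with h | h
  · exact (List.pairwise_iff_getElem.1 hp i j (by omega) hj h).le
  · have : i = j := by omega
    subst this; exact le_rfl

theorem drop_take_mem {p : List ℕ} (hp : p.Pairwise (· < ·)) {j l x : ℕ} (hj : j < p.length)
    (hx : x ∈ (p.take (j + 1)).drop l) : x ∈ p ∧ p.getD l 0 ≤ x ∧ x ≤ p.getD j 0 := by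
  refine ⟨List.mem_of_mem_take (List.mem_of_mem_drop hx), ?_,
    le_of_mem_take hp hj (List.mem_of_mem_drop hx)⟩
  rw [List.drop_take] at hx
  exact le_of_mem_drop hp (List.mem_of_mem_take hx)

theorem eq_nil_of_size {x : GluingTree} (h : x.size = 0) : x = nil := by
  cases x <;> simp_all [size]

theorem sound_nil : Sound nil where
  perm := by simp [GluingTree.perm, size, permutationWords]
  sortable := by
    change (stackSort (stackSort (stackSort []))).Pairwise _
    simp [stackSort_nil]
  split := by simp [cuts]
  split_of_flag := by simp [cuts]
  sorted := by simp [positions, cuts]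
  zero := by simp [positions, cuts, size]
  last h := (h rfl).elim

/-- A maximum in front is moved to the end by the first pass and stays there. All splits survive,
and a new one arises just below the maximum, already after one pass. -/
theorem sound_single {b : GluingTree} (hb : Sound b) : Sound (single b) := by
  have hlt : ∀ x ∈ b.perm, x < b.size + 1 := fun x hx => by
    have := (mem_permutationWords_bounds hb.perm).1 hx; omega
  have e1 : stackSort (single b).perm = stackSort b.perm ++ [b.size + 1] := by
    have := stackSort_append_cons (L := []) (by simp) hlt
    rw [GluingTree.perm]; simpa [stackSort_nil] using this
  have e2 : stackSort (stackSort (single b).perm) =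
      stackSort (stackSort b.perm) ++ [b.size + 1] := by
    rw [e1, stackSort_concat]
    exact fun x hx => hlt x (mem_stackSort.1 hx)
  have hpos : positions (single b).cuts (single b).size =
      positions b.cuts b.size ++ [b.size + 1] := by simp [positions, cuts, size]
  have hle : ∀ c ∈ (single b).cuts, c.2 ≤ b.size := by
    intro c hc
    have h1 : c.2 ∈ positions b.cuts b.size := by
      simp only [cuts, List.mem_append, List.mem_singleton] at hc
      rcases hc with hc | rfl
      · exact List.mem_append_left _ (List.mem_map_of_mem hc)
      · simp [positions]
    rcases List.mem_append.1 h1 with h2 | h2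
    · exact ((List.pairwise_append.1 hb.sorted).2.2 _ h2 b.size (by simp)).le
    · rw [List.mem_singleton] at h2; omega
  refine ⟨?_, ?_, ?_, ?_, ?_, ?_, ?_⟩
  · change (_ :: _).Perm (List.range' 1 (b.size + 1))
    rw [List.range'_concat]
    have h := List.Perm.cons (b.size + 1) hb.perm
    refine h.trans ?_
    rw [show 1 + 1 * b.size = b.size + 1 by ring]
    exact (List.perm_append_singleton _ _).symm
  · change IsStackSortable 1 (stackSort (stackSort (single b).perm))
    rw [e2]
    refine IsStackSortable.sum hb.sortable (isStackSortable_nil.cons (by simp)) ?_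
    intro x hx y hy
    rw [List.mem_singleton] at hy
    exact hy ▸ hlt x (mem_stackSort.1 (mem_stackSort.1 hx))
  · intro c hc
    rw [e2]
    have := hle c hc
    refine Split.append_high ?_ (by simp; omega)
    simp only [cuts, List.mem_append, List.mem_singleton] at hc
    rcases hc with hc | rfl
    · exact hb.split c hc
    · exact Split.of_low fun x hx => by
        have := hlt x (mem_stackSort.1 (mem_stackSort.1 hx)); simp only; omega
  · intro c hc hf
    rw [e1]
    have := hle c hc
    refine Split.append_high ?_ (by simp; omega)
    simp only [cuts, List.mem_append, List.mem_singleton] at hc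
    rcases hc with hc | rfl
    · exact hb.split_of_flag c hc hf
    · exact Split.of_low fun x hx => by
        have := hlt x (mem_stackSort.1 hx); simp only; omega
  · rw [hpos]
    refine List.pairwise_append.2 ⟨hb.sorted, by simp, ?_⟩
    intro x hx y hy
    rw [List.mem_singleton] at hy
    have : x ≤ b.size := by
      rcases List.mem_append.1 hx with h2 | h2
      · exact ((List.pairwise_append.1 hb.sorted).2.2 _ h2 b.size (by simp)).le
      · rw [List.mem_singleton] at h2; omega
    omega
  · obtain ⟨t, ht⟩ := hb.zero
    exact ⟨t ++ [b.size + 1], by rw [hpos, ht]; rfl⟩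
  · exact fun _ => ⟨b.cuts, by simp [cuts, size]⟩

end GluingTree

end StackSorting

/-! ### Soundness of the gluing of two trees -/

namespace StackSorting

namespace GluingTree

theorem Sound.mem_perm {x : GluingTree} (h : Sound x) {k : ℕ} :
    k ∈ x.perm ↔ 1 ≤ k ∧ k ≤ x.size := mem_permutationWords_bounds h.perm

theorem Sound.nodup {x : GluingTree} (h : Sound x) : x.perm.Nodup :=
  (List.Perm.nodup_iff h.perm).2 List.nodup_range'

theorem Sound.le_size {x : GluingTree} (h : Sound x) {k : ℕ}
    (hk : k ∈ positions x.cuts x.size) : k ≤ x.size := by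
  rcases List.mem_append.1 hk with h2 | h2
  · exact ((List.pairwise_append.1 h.sorted).2.2 _ h2 x.size (by simp)).le
  · rw [List.mem_singleton] at h2; omega

theorem Sound.split_of_mem {x : GluingTree} (h : Sound x) {k : ℕ}
    (hk : k ∈ positions x.cuts x.size) : Split (stackSort (stackSort x.perm)) k := by
  rcases List.mem_append.1 hk with h2 | h2
  · obtain ⟨c, hc, rfl⟩ := List.mem_map.1 h2
    exact h.split c hc
  · rw [List.mem_singleton] at h2
    subst h2
    exact Split.of_low fun y hy => (h.mem_perm.1 (mem_stackSort.1 (mem_stackSort.1 hy))).2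

theorem length_positions (c : List (Bool × ℕ)) (n : ℕ) :
    (positions c n).length = c.length + 1 := by simp [positions]

theorem pos_mem {b : GluingTree} {j : ℕ} (hj : j ≤ b.cuts.length) :
    b.pos j ∈ positions b.cuts b.size := by
  have : j < (positions b.cuts b.size).length := by rw [length_positions]; omega
  rw [pos, List.getD_eq_getElem _ _ this]
  exact List.getElem_mem _

theorem Sound.pos_lt_pos {b : GluingTree} (h : Sound b) {i j : ℕ} (hij : i < j)
    (hj : j ≤ b.cuts.length) : b.pos i < b.pos j := by
  have h2 : j < (positions b.cuts b.size).length := by rw [length_positions]; omega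
  rw [pos, pos, List.getD_eq_getElem _ _ h2, List.getD_eq_getElem _ _ (hij.trans h2)]
  exact List.pairwise_iff_getElem.1 h.sorted i j _ _ hij

theorem Sound.pos_le_pos {b : GluingTree} (h : Sound b) {i j : ℕ} (hij : i ≤ j)
    (hj : j ≤ b.cuts.length) : b.pos i ≤ b.pos j := by
  rcases hij.eq_or_lt with rfl | hij
  · exact le_rfl
  · exact (h.pos_lt_pos hij hj).le

theorem Sound.pos_zero {b : GluingTree} (h : Sound b) : b.pos 0 = 0 := by
  obtain ⟨t, ht⟩ := h.zero
  rw [pos, ht]; rfl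

theorem Sound.split_pos {b : GluingTree} (h : Sound b) {j : ℕ} (hj : IsMark (word b) j) :
    Split (stackSort b.perm) (b.pos j) := by
  have hle : j ≤ b.cuts.length := by simpa [word] using hj.le
  rcases hle.eq_or_lt with heq | hlt
  · have : b.pos j = b.size := by simp [pos, positions, heq]
    rw [this]
    exact Split.of_low fun y hy => (h.mem_perm.1 (mem_stackSort.1 hy)).2
  · have h1 : b.cuts[j].1 = true := by
      have := hj.getElem (by simpa [word] using hlt)
      simpa [word] using this
    have h2 : b.pos j = b.cuts[j].2 := by
      simp [pos, positions, List.getElem?_append_left, hlt]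
    rw [h2]
    exact h.split_of_flag _ (List.getElem_mem _) h1

/-- The data that the permutation of a node is made of. -/
theorem node_data {a b : GluingTree} {j l : ℕ} (ha0 : a ≠ nil) (hb : Sound b)
    (hj : IsMark (word b) j) (hl : l ≤ j) (hla : l = 0 ∨ 2 ≤ a.size) :
    1 ≤ a.size ∧ j ≤ b.cuts.length ∧ b.pos l ≤ b.pos j ∧ b.pos j ≤ b.size ∧
      (b.pos l = 0 ∨ 2 ≤ a.size) := by
  have hjl : j ≤ b.cuts.length := by simpa [word] using hj.le
  refine ⟨?_, hjl, hb.pos_le_pos hl hjl, hb.le_size (pos_mem hjl), ?_⟩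
  · by_contra h
    exact ha0 (eq_nil_of_size (by omega))
  · rcases hla with rfl | h
    · exact Or.inl hb.pos_zero
    · exact Or.inr h

/-- The two relabellings have disjoint images: `makeRoom` skips the two values taken by the raised
entries. -/
theorem node_mem_permutationWords {a b : GluingTree} {j l : ℕ} (ha : Sound a) (hb : Sound b)
    (hA : 1 ≤ a.size) (he : b.pos l ≤ b.pos j) (hB : b.pos j ≤ b.size)
    (heA : b.pos l = 0 ∨ 2 ≤ a.size) :
    (node a b j l).perm ∈ permutationWords (node a b j l).size := by
  have hf := raiseTop_strictMono (A := a.size) he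
  have hg := makeRoom_strictMono (b := b.pos j) hA heA
  have hlen : (node a b j l).perm.length = (node a b j l).size := by
    have h1 := List.Perm.length_eq ha.perm
    have h2 := List.Perm.length_eq hb.perm
    simp only [List.length_range'] at h1 h2
    simp [GluingTree.perm, size, h1, h2]; omega
  have hfb : ∀ x ∈ a.perm.map (raiseTop a.size (b.pos l) (b.pos j)),
      1 ≤ x ∧ x ≤ a.size + b.size ∧ ∀ y ∈ b.perm.map (makeRoom a.size (b.pos l) (b.pos j)),
        x ≠ y := by
    intro x hx
    obtain ⟨x, hx', rfl⟩ := List.mem_map.1 hx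
    have h1 := ha.mem_perm.1 hx'
    refine ⟨?_, ?_, ?_⟩
    · unfold raiseTop; split_ifs <;> omega
    · unfold raiseTop; split_ifs <;> omega
    · intro y hy
      obtain ⟨y, hy', rfl⟩ := List.mem_map.1 hy
      have h2 := hb.mem_perm.1 hy'
      unfold raiseTop makeRoom
      split_ifs <;> omega
  have hgb : ∀ y ∈ b.perm.map (makeRoom a.size (b.pos l) (b.pos j)),
      1 ≤ y ∧ y ≤ a.size + b.size := by
    intro y hy
    obtain ⟨y, hy', rfl⟩ := List.mem_map.1 hy
    have h2 := hb.mem_perm.1 hy'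
    unfold makeRoom
    split_ifs <;> omega
  have hnd : (node a b j l).perm.Nodup := by
    rw [GluingTree.perm, List.nodup_append, List.nodup_cons]
    refine ⟨ha.nodup.map hf.injective, ⟨?_, hb.nodup.map hg.injective⟩, ?_⟩
    · intro h
      have := hgb _ h; omega
    · intro x hx y hy
      rcases List.mem_cons.1 hy with rfl | hy
      · have := (hfb x hx).2.1; omega
      · exact (hfb x hx).2.2 y hy
  -- A duplicate-free word of the right length with entries in the right range is a permutation.
  refine (List.subperm_of_subset hnd ?_).perm_of_length_le (by simp [hlen])
  intro x hx
  rw [List.mem_range'_1]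
  simp only [GluingTree.perm, List.mem_append, List.mem_cons] at hx
  simp only [size]
  rcases hx with hx | rfl | hx
  · have := hfb x hx; omega
  · omega
  · have := hgb x hx; omega

/-- The three cases match `split_glue_lower`, `split_glue_middle` and `split_glue_upper`. A middle
cut carries a flag only at `k = 0` with `l = 0`, where the second largest left entry is not raised.
-/
theorem mem_cuts_node {a b : GluingTree} {j l : ℕ} (ha : Sound a) (ha0 : a ≠ nil) (hb : Sound b)
    (hj : j ≤ b.cuts.length) {c : Bool × ℕ} (hc : c ∈ (node a b j l).cuts) :
    (c ∈ a.cuts ∧ c.2 + 2 ≤ a.size) ∨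
    (∃ k, c.2 = a.size - 1 + k ∧ k ∈ positions b.cuts b.size ∧ b.pos l ≤ k ∧ k ≤ b.pos j ∧
      (c.1 = true → l = 0 ∧ k = 0)) ∨
    (∃ k, c.2 = k + a.size ∧ b.pos j ≤ k ∧ ((c.1, k) ∈ b.cuts ∨ k = b.size)) := by
  have hjp : j < (positions b.cuts b.size).length := by rw [length_positions]; omega
  simp only [cuts, List.mem_append, List.mem_singleton] at hc
  rcases hc with hc | hc | hc | rfl
  · left
    obtain ⟨i, hi⟩ := ha.last ha0
    have hs := ha.sorted
    rw [hi] at hc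
    simp only [List.dropLast_concat] at hc
    refine ⟨by rw [hi]; exact List.mem_append_left _ hc, ?_⟩
    rw [positions, List.pairwise_append, hi, List.map_append, List.pairwise_append] at hs
    have h1 := hs.1.2.2 c.2 (List.mem_map_of_mem hc) (a.size - 1) (by simp)
    omega
  · right; left
    obtain ⟨h1, h2⟩ := mem_flagHead hc
    obtain ⟨k, hk, hk'⟩ := List.mem_map.1 h1
    obtain ⟨h3, h4, h5⟩ := drop_take_mem hb.sorted hjp hk
    refine ⟨k, hk'.symm, h3, h4, h5, ?_⟩
    intro hf
    obtain ⟨h6, h7⟩ := h2 hf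
    have hl : l = 0 := by simpa using h6
    refine ⟨hl, ?_⟩
    obtain ⟨t, ht⟩ := hb.zero
    subst hl
    rw [ht] at h7
    simp at h7
    omega
  · right; right
    obtain ⟨d, hd, rfl⟩ := List.mem_map.1 hc
    refine ⟨d.2, rfl, ?_, Or.inl (List.mem_of_mem_drop hd)⟩
    refine le_of_mem_drop hb.sorted ?_
    rw [positions, List.drop_append_of_le_length (by simpa using hj), ← List.map_drop]
    exact List.mem_append_left _ (List.mem_map_of_mem hd)
  · right; right
    exact ⟨b.size, by simp only; omega, hb.le_size (pos_mem hj), Or.inr rfl⟩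

theorem positions_node {a b : GluingTree} {j l : ℕ} {i : List (Bool × ℕ)}
    (hi : a.cuts = i ++ [(true, a.size - 1)]) (hj : j ≤ b.cuts.length) :
    positions (node a b j l).cuts (node a b j l).size = i.map Prod.snd ++
      (((((positions (cuts b) (size b)).take (j + 1)).drop l).map fun k => a.size - 1 + k) ++
        (((positions b.cuts b.size).drop j).map (· + a.size) ++ [a.size + b.size + 1])) := by
  have hup : ((b.cuts.drop j).map fun c => (c.1, c.2 + a.size)).map Prod.snd ++
      [a.size + b.size] = ((positions b.cuts b.size).drop j).map (· + a.size) := by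
    rw [positions, List.drop_append_of_le_length (by simpa using hj), ← List.map_drop]
    simp [add_comm, Function.comp_def]
  rw [← hup]
  simp [positions, cuts, hi, flagHead_snd, size]

theorem sorted_node {a b : GluingTree} {j l : ℕ} (ha : Sound a) (ha0 : a ≠ nil) (hb : Sound b)
    (hA : 1 ≤ a.size) (hj : j ≤ b.cuts.length) :
    (positions (node a b j l).cuts (node a b j l).size).Pairwise (· < ·) := by
  have hjp : j < (positions b.cuts b.size).length := by rw [length_positions]; omega
  obtain ⟨i, hi⟩ := ha.last ha0
  have hs := ha.sorted
  rw [positions, hi, List.map_append, List.pairwise_append, List.pairwise_append] at hs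
  rw [positions_node hi hj]
  refine List.pairwise_append.2 ⟨hs.1.1, List.pairwise_append.2 ⟨?_,
    List.pairwise_append.2 ⟨?_, by simp, ?_⟩, ?_⟩, ?_⟩
  · rw [List.pairwise_map]
    refine List.Pairwise.imp ?_ (List.Pairwise.drop (List.Pairwise.take hb.sorted))
    intro x y h; omega
  · rw [List.pairwise_map]
    refine List.Pairwise.imp ?_ (List.Pairwise.drop hb.sorted)
    intro x y h; omega
  · intro x hx y hy
    obtain ⟨x, hx', rfl⟩ := List.mem_map.1 hx
    rw [List.mem_singleton] at hy
    have := hb.le_size (List.mem_of_mem_drop hx')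
    omega
  · intro x hx y hy
    obtain ⟨x, hx', rfl⟩ := List.mem_map.1 hx
    obtain ⟨h1, h2, h3⟩ := drop_take_mem hb.sorted hjp hx'
    rcases List.mem_append.1 hy with hy | hy
    · obtain ⟨y, hy', rfl⟩ := List.mem_map.1 hy
      have := le_of_mem_drop hb.sorted hy'
      omega
    · rw [List.mem_singleton] at hy
      have := hb.le_size h1
      omega
  · intro x hx y hy
    have h0 := hs.1.2.2 x hx (a.size - 1) (by simp)
    simp only [List.mem_append, List.mem_singleton, List.mem_map] at hy
    rcases hy with ⟨y, hy, rfl⟩ | ⟨y, hy, rfl⟩ | rfl <;> omega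

/-- The mark at `j` says that s(right) splits at `pos b j`, which provides `β₁` and `β₂` for the
second pass. For the third pass it suffices that s²(right) splits at `pos b l`, so `l` needs no
flag. -/
theorem sound_node {a b : GluingTree} {j l : ℕ} (ha : Sound a) (ha0 : a ≠ nil) (hb : Sound b)
    (hj : IsMark (word b) j) (hl : l ≤ j) (hla : l = 0 ∨ 2 ≤ a.size) :
    Sound (node a b j l) := by
  obtain ⟨hA, hjl, he, hB, heA⟩ := node_data ha0 hb hj hl hla
  obtain ⟨ta, hta, hta'⟩ := stackSort_eq_concat (l := a.perm) (n := a.size)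
    (ha.mem_perm.2 ⟨hA, le_rfl⟩) (fun x hx => (ha.mem_perm.1 hx).2) ha.nodup
  obtain ⟨β₁, β₂, hβ, hβ₁, hβ₂⟩ := (hb.split_pos hj).exists_append
  have memβ : ∀ x, x ∈ β₁ ∨ x ∈ β₂ → 1 ≤ x ∧ x ≤ b.size := fun x hx =>
    hb.mem_perm.1 (mem_stackSort.1 (by rw [hβ]; exact List.mem_append.2 hx))
  have memta : ∀ x ∈ ta, 1 ≤ x := fun x hx =>
    (ha.mem_perm.1 (mem_stackSort.1 (by rw [hta]; exact List.mem_append_left _ hx))).1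
  have e1 := stackSort_glue (B := b.size) hA he hB heA hta hβ
    (fun x hx => (ha.mem_perm.1 hx).2) (fun x hx => (hb.mem_perm.1 hx).2)
  have e2 := stackSort_stackSort_glue (B := b.size) hA he hB heA hta' hβ₁
    (fun x hx => ⟨hβ₂ x hx, (memβ x (Or.inr hx)).2⟩)
  rw [← e1] at e2
  have hsa : stackSort (stackSort a.perm) = stackSort ta ++ [a.size] := by
    rw [hta, stackSort_concat hta']
  have hsb : stackSort (stackSort b.perm) = stackSort β₁ ++ stackSort β₂ := by
    rw [hβ, stackSort_append]
    intro x hx y hy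
    exact (hβ₁ x hx).trans_lt (hβ₂ y hy)
  have hX' : ∀ x ∈ stackSort ta, x < a.size := fun x hx => hta' x (mem_stackSort.1 hx)
  have hY' : ∀ x ∈ stackSort β₁, 1 ≤ x ∧ x ≤ b.pos j := fun x hx =>
    ⟨(memβ x (Or.inl (mem_stackSort.1 hx))).1, hβ₁ x (mem_stackSort.1 hx)⟩
  have hZ' : ∀ x ∈ stackSort β₂, b.pos j < x ∧ x ≤ b.size := fun x hx =>
    ⟨hβ₂ x (mem_stackSort.1 hx), (memβ x (Or.inr (mem_stackSort.1 hx))).2⟩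
  have hX : (2 ≤ a.size ∧ ∃ ρ, stackSort ta = ρ ++ [a.size - 1] ∧ ∀ x ∈ ρ, x < a.size - 1) ∨
      stackSort ta = [] := by
    -- A left part of size 1 has no second largest entry.
    rcases Nat.lt_or_ge a.size 2 with h | h
    · right
      have : ta = [] := List.eq_nil_iff_forall_not_mem.2 fun x hx => by
        have := memta x hx; have := hta' x hx; omega
      rw [this, stackSort_nil]
    · refine Or.inl ⟨h, stackSort_eq_concat (n := a.size - 1) ?_ ?_ ?_⟩
      · have h1 : a.size - 1 ∈ stackSort a.perm :=
          mem_stackSort.2 (ha.mem_perm.2 ⟨by omega, by omega⟩)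
        rw [hta] at h1
        rcases List.mem_append.1 h1 with h1 | h1
        · exact h1
        · rw [List.mem_singleton] at h1; omega
      · intro x hx
        have := hta' x hx; omega
      · have h1 := (List.Perm.nodup_iff (stackSort_perm a.perm)).2 ha.nodup
        rw [hta] at h1
        exact (List.nodup_append.1 h1).1
  have hlow : ∀ x ∈ ta.map (raiseTop a.size (b.pos l) (b.pos j)) , x ≤ a.size + b.pos j := by
    intro x hx
    obtain ⟨x, hz, rfl⟩ := List.mem_map.1 hx
    have := hta' x hz
    unfold raiseTop; split_ifs <;> omega
  have hlow' : ∀ x ∈ (stackSort ta).map (raiseTop a.size (b.pos l) (b.pos j)),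
      x ≤ a.size + b.pos j := by
    intro x hx
    obtain ⟨x, hz, rfl⟩ := List.mem_map.1 hx
    exact hlow _ (List.mem_map_of_mem (mem_stackSort.1 hz))
  have hroom : ∀ x, makeRoom a.size (b.pos l) (b.pos j) x + 2 ≥ x + a.size := by
    intro x; unfold makeRoom; split_ifs <;> omega
  have hmid : ∀ x ∈ β₁.map (makeRoom a.size (b.pos l) (b.pos j)), x ≤ a.size + b.pos j := by
    intro x hx
    obtain ⟨x, hz, rfl⟩ := List.mem_map.1 hx
    have := hβ₁ x hz
    unfold makeRoom; split_ifs <;> omega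
  have hmid' : ∀ x ∈ (stackSort β₁).map (makeRoom a.size (b.pos l) (b.pos j)),
      x ≤ a.size + b.pos j := by
    intro x hx
    obtain ⟨x, hz, rfl⟩ := List.mem_map.1 hx
    exact hmid _ (List.mem_map_of_mem (mem_stackSort.1 hz))
  refine ⟨node_mem_permutationWords ha hb hA he hB heA, ?_, ?_, ?_,
    sorted_node ha ha0 hb hA hjl, ?_, ?_⟩
  · change IsStackSortable 1 (stackSort (stackSort (node a b j l).perm))
    rw [GluingTree.perm, e2]
    refine IsStackSortable.glue hA he hB heA hX hX' ?_ hY' hZ' ?_ ?_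
    · rw [← hsa]; exact ha.sortable
    · rw [← hsb]; exact hb.sortable
    · rw [← hsb]; exact hb.split_of_mem (pos_mem (hl.trans hjl))
  · intro c hc
    rw [GluingTree.perm, e2]
    rcases mem_cuts_node ha ha0 hb hjl hc with ⟨h1, h2⟩ | ⟨k, h1, h2, h3, h4, -⟩ | ⟨k, h1, h2, h3⟩
    · refine split_glue_lower h2 (hsa ▸ ha.split c h1) hX' ?_
      intro y hy
      simp only [List.mem_append, List.mem_singleton, List.mem_map] at hy
      rcases hy with ⟨y, hy, rfl⟩ | rfl | ⟨y, hy, rfl⟩ | rfl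
      · have := hroom y; have := hY' y hy; omega
      · omega
      · have := hroom y; have := hZ' y hy; omega
      · omega
    · rw [h1]
      exact split_glue_middle hA hB h3 h4 (hsb ▸ hb.split_of_mem h2) hX' hY'
        fun x hx => (hZ' x hx).1
    · have hk : k ∈ positions b.cuts b.size := by
        rcases h3 with h3 | rfl
        · exact List.mem_append_left _ (List.mem_map.2 ⟨_, h3, rfl⟩)
        · simp [positions]
      have main := split_glue_upper (A := a.size) (u := (stackSort ta).map (raiseTop a.size (b.pos l) (b.pos j)) ++
        ((stackSort β₁).map (makeRoom a.size (b.pos l) (b.pos j)) ++ [a.size + b.pos j]))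
        he h2 (hb.le_size hk) (hsb ▸ hb.split_of_mem hk).right ?_ (fun x hx => (hZ' x hx).1)
      · rw [h1]
        simpa only [List.append_assoc] using main
      · intro x hx
        rcases List.mem_append.1 hx with hx | hx
        · exact hlow' x hx
        rcases List.mem_append.1 hx with hx | hx
        · exact hmid' x hx
        · rw [List.mem_singleton] at hx; omega
  · intro c hc hf
    rw [GluingTree.perm, e1]
    rcases mem_cuts_node ha ha0 hb hjl hc with ⟨h1, h2⟩ | ⟨k, h1, -, -, -, h5⟩ | ⟨k, h1, h2, h3⟩
    · refine split_glue_lower h2 (hta ▸ ha.split_of_flag c h1 hf) hta' ?_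
      intro y hy
      simp only [List.mem_append, List.mem_singleton, List.mem_map] at hy
      rcases hy with rfl | ⟨y, hy, rfl⟩ | ⟨y, hy, rfl⟩ | rfl
      · omega
      · have := hroom y; have := memβ y (Or.inl hy); omega
      · have := hroom y; have := memβ y (Or.inr hy); omega
      · omega
    · obtain ⟨rfl, rfl⟩ := h5 hf
      have h0 := hb.pos_zero
      rw [h1]
      refine Split.append_low ?_ (Split.of_high ?_)
      · intro x hx
        obtain ⟨x, hz, rfl⟩ := List.mem_map.1 hx
        have := hta' x hz
        unfold raiseTop; split_ifs <;> omega
      · intro y hy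
        have key : ∀ y, 1 ≤ y → a.size ≤ makeRoom a.size (b.pos 0) (b.pos j) y := by
          intro y hy; unfold makeRoom; split_ifs <;> omega
        simp only [List.mem_append, List.mem_singleton, List.mem_map] at hy
        rcases hy with rfl | ⟨y, hy, rfl⟩ | ⟨y, hy, rfl⟩ | rfl
        · omega
        · have := key y (memβ y (Or.inl hy)).1; omega
        · have := key y (memβ y (Or.inr hy)).1; omega
        · omega
    · have hk : k ∈ positions b.cuts b.size := by
        rcases h3 with h3 | rfl
        · exact List.mem_append_left _ (List.mem_map.2 ⟨_, h3, rfl⟩)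
        · simp [positions]
      have hs : Split (stackSort b.perm) k := by
        rcases h3 with h3 | rfl
        · exact hb.split_of_flag _ h3 hf
        · exact Split.of_low fun y hy => (hb.mem_perm.1 (mem_stackSort.1 hy)).2
      rw [hβ] at hs
      have main := split_glue_upper (A := a.size) (u := ta.map (raiseTop a.size (b.pos l) (b.pos j)) ++
        ([a.size + b.pos j] ++ β₁.map (makeRoom a.size (b.pos l) (b.pos j))))
        he h2 (hb.le_size hk) hs.right ?_ hβ₂
      · rw [h1]
        simpa only [List.append_assoc] using main
      · intro x hx
        rcases List.mem_append.1 hx with hx | hx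
        · exact hlow x hx
        rcases List.mem_append.1 hx with hx | hx
        · rw [List.mem_singleton] at hx; omega
        · exact hmid x hx
  · obtain ⟨i, hi⟩ := ha.last ha0
    obtain ⟨t, ht⟩ := ha.zero
    rw [positions_node hi hjl]
    cases i with
    | cons c i =>
      simp only [hi, positions, List.cons_append, List.map_cons, List.cons.injEq] at ht
      exact ⟨_, by rw [List.map_cons, ht.1, List.cons_append]⟩
    | nil =>
      simp only [hi, positions, List.nil_append, List.map_cons, List.cons_append,
        List.cons.injEq] at ht
      -- Here 0 is the only cut of `a`, so `a` has size 1. The cut 0 of the node then comes from the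
      -- first position of `b`, which is kept because `l = 0`.
      have hl0 : l = 0 := hla.resolve_right (by omega)
      obtain ⟨t', ht'⟩ := hb.zero
      exact ⟨_, by
        rw [hl0, ht', List.take_succ_cons, List.drop_zero, List.map_cons, ht.1]
        simp only [List.map_nil, List.nil_append, List.cons_append, add_zero]
        rfl⟩
  · intro _
    rw [cuts, ← List.append_assoc, ← List.append_assoc]
    simp only [size, Nat.add_sub_cancel]
    exact ⟨_, rfl⟩

end GluingTree

end StackSorting

/-! ### Distinct trees give distinct permutations; words of flags -/

namespace StackSorting

namespace GluingTree

theorem Valid.sound {x : GluingTree} (h : x.Valid) : Sound x := by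
  induction x with
  | nil => exact sound_nil
  | single b ih => exact sound_single (ih h)
  | node a b j l iha ihb =>
    obtain ⟨h1, h2, h3, h4, h5, h6⟩ := h
    exact sound_node (iha h1) h2 (ihb h3) h4 h5 h6

theorem append_cons_inj {n : ℕ} {L R L' R' : List ℕ} (h : L ++ n :: R = L' ++ n :: R')
    (hL : n ∉ L) (hL' : n ∉ L') : L = L' ∧ R = R' := by
  induction L generalizing L' with
  | nil => cases L' with
    | nil => simpa using h
    | cons y L' => exact (hL' (by simp [(List.cons.inj h).1])).elim
  | cons x L ih => cases L' with
    | nil => exact (hL (by simp [(List.cons.inj h).1])).elim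
    | cons y L' =>
      simp only [List.cons_append, List.cons.injEq] at h
      simp only [List.mem_cons, not_or] at hL hL'
      obtain ⟨h1, h2⟩ := ih h.2 hL.2 hL'.2
      exact ⟨by rw [h.1, h1], h2⟩

theorem Sound.length_perm {x : GluingTree} (h : Sound x) : x.perm.length = x.size := by
  have := List.Perm.length_eq h.perm
  simpa using this

/-- The two largest entries of the relabelled left part are `A + b` and `A - 1 + e`, so the
parameters can be read off. One inequality each is enough, since the lemma is applied in both
directions. -/
theorem raiseTop_params_inj {L L' : List ℕ} {A e b e' b' : ℕ} (hL : ∀ k, k ∈ L ↔ 1 ≤ k ∧ k ≤ A)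
    (hL' : ∀ k, k ∈ L' ↔ 1 ≤ k ∧ k ≤ A) (hA : 1 ≤ A) (he : e ≤ b) (he' : e' ≤ b')
    (h : L.map (raiseTop A e b) = L'.map (raiseTop A e' b')) : b ≤ b' ∧ (2 ≤ A → e ≤ e') := by
  have top : raiseTop A e b A = A + b := by unfold raiseTop; split_ifs <;> omega
  have hb : b ≤ b' := by
    have h1 : raiseTop A e b A ∈ L'.map (raiseTop A e' b') :=
      h ▸ List.mem_map_of_mem ((hL A).2 ⟨hA, le_rfl⟩)
    obtain ⟨x, hx, hx'⟩ := List.mem_map.1 h1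
    have := (hL' x).1 hx
    rw [top] at hx'
    unfold raiseTop at hx'
    split_ifs at hx' <;> omega
  refine ⟨hb, fun hA2 => ?_⟩
  have h1 : raiseTop A e b (A - 1) ∈ L'.map (raiseTop A e' b') :=
    h ▸ List.mem_map_of_mem ((hL (A - 1)).2 ⟨by omega, by omega⟩)
  have h2 : raiseTop A e' b' A ∈ L.map (raiseTop A e b) :=
    h ▸ List.mem_map_of_mem ((hL' A).2 ⟨hA, le_rfl⟩)
  obtain ⟨x, hx, hx'⟩ := List.mem_map.1 h1
  obtain ⟨y, hy, hy'⟩ := List.mem_map.1 h2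
  have := (hL' x).1 hx
  have := (hL y).1 hy
  have e1 : raiseTop A e b (A - 1) = A - 1 + e := by unfold raiseTop; split_ifs <;> omega
  have e2 : raiseTop A e' b' A = A + b' := by unfold raiseTop; split_ifs <;> omega
  rw [e1] at hx'
  rw [e2] at hy'
  unfold raiseTop at hx' hy'
  split_ifs at hx' hy' <;> omega

/-- A valid tree is determined by its permutation. -/
theorem perm_inj {x y : GluingTree} (hx : x.Valid) (hy : y.Valid) (h : x.perm = y.perm) :
    x = y := by
  induction x generalizing y with
  | nil =>
    have := hy.sound.length_perm
    rw [← h] at this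
    exact (eq_nil_of_size this.symm).symm
  | single b ih =>
    have hs := hy.sound.length_perm
    rw [← h, hx.sound.length_perm] at hs
    cases y with
    | nil => simp [size] at hs
    | single b' =>
      simp only [GluingTree.perm, List.cons.injEq] at h
      rw [ih (y := b') hx hy h.2]
    | node a b' j l =>
      -- A `single` starts with its maximum, whereas a node starts with an entry of its nonempty
      -- left part.
      exfalso
      obtain ⟨h1, h2, h3, h4, h5, h6⟩ := hy
      obtain ⟨hA, hjl, he, hB, heA⟩ := node_data h2 h3.sound h4 h5 h6
      have hmem : ∀ k, k ∈ a.perm ↔ _ := fun k => h1.sound.mem_perm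
      have hne : a.perm ≠ [] := by
        intro h0
        have := h1.sound.length_perm
        rw [h0, List.length_nil] at this; omega
      obtain ⟨z, L, hz⟩ := List.exists_cons_of_ne_nil hne
      have hz' := (hmem z).1 (by simp [hz])
      simp only [GluingTree.perm, hz, List.map_cons, List.cons_append, List.cons.injEq] at h
      simp only [size] at hs
      have h7 := h.1
      unfold raiseTop at h7
      split_ifs at h7 <;> omega
  | node a b j l iha ihb =>
    have hs := hy.sound.length_perm
    rw [← h, hx.sound.length_perm] at hs
    have hxs := hx
    obtain ⟨h1, h2, h3, h4, h5, h6⟩ := hx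
    obtain ⟨hA, hjl, he, hB, heA⟩ := node_data h2 h3.sound h4 h5 h6
    cases y with
    | nil => simp [size] at hs
    | single b' =>
      exfalso
      have hne : a.perm ≠ [] := by
        intro h0
        have := h1.sound.length_perm
        rw [h0, List.length_nil] at this; omega
      obtain ⟨z, L, hz⟩ := List.exists_cons_of_ne_nil hne
      have hz' := h1.sound.mem_perm.1 (show z ∈ a.perm by simp [hz])
      simp only [GluingTree.perm, hz, List.map_cons, List.cons_append, List.cons.injEq] at h
      simp only [size] at hs
      have h7 := h.1
      unfold raiseTop at h7
      split_ifs at h7 <;> omega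
    | node a' b' j' l' =>
      obtain ⟨h1', h2', h3', h4', h5', h6'⟩ := hy
      obtain ⟨hA', hjl', he', hB', heA'⟩ := node_data h2' h3'.sound h4' h5' h6'
      have key : ∀ {a b : GluingTree} {e c : ℕ}, a.Valid → c ≤ b.size → e ≤ c →
          a.size + b.size + 1 ∉ a.perm.map (raiseTop a.size e c) := by
        intro a b e c hv hc hec hm
        obtain ⟨x, hx, hx'⟩ := List.mem_map.1 hm
        have := hv.sound.mem_perm.1 hx
        unfold raiseTop at hx'
        split_ifs at hx' <;> omega
      simp only [size] at hs
      have hN : a.size + b.size + 1 = a'.size + b'.size + 1 := hs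
      simp only [GluingTree.perm] at h
      have k1 := key h1 hB he
      have k2 := key h1' hB' he'
      rw [← hN] at h k2
      obtain ⟨e1, e2⟩ := append_cons_inj h k1 k2
      have hAA : a.size = a'.size := by
        have := congrArg List.length e1
        simpa [h1.sound.length_perm, h1'.sound.length_perm] using this
      rw [← hAA] at e1 e2 heA'
      have p1 := raiseTop_params_inj (fun k => h1.sound.mem_perm)
        (fun k => by rw [hAA]; exact h1'.sound.mem_perm) hA he he' e1
      have p2 := raiseTop_params_inj (fun k => by rw [hAA]; exact h1'.sound.mem_perm)
        (fun k => h1.sound.mem_perm) hA he' he e1.symm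
      have eb : b.pos j = b'.pos j' := le_antisymm p1.1 p2.1
      have ee : b.pos l = b'.pos l' := by
        rcases Nat.lt_or_ge a.size 2 with h7 | h7
        · rw [heA.resolve_right (by omega), heA'.resolve_right (by omega)]
        · exact le_antisymm (p1.2 h7) (p2.2 h7)
      rw [← eb, ← ee] at e1 e2
      have ha : a = a' := iha h1 h1' ((raiseTop_strictMono he).injective.list_map e1)
      have hb : b = b' := ihb h3 h3' ((makeRoom_strictMono hA heA).injective.list_map e2)
      subst ha hb
      -- Positions strictly increase, so equal heights force equal indices.
      have inj : ∀ {i k : ℕ}, i ≤ b.cuts.length → k ≤ b.cuts.length → b.pos i = b.pos k →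
          i = k := by
        intro i k hi hk hik
        rcases Nat.lt_trichotomy i k with h7 | h7 | h7
        · have := h3.sound.pos_lt_pos h7 hk; omega
        · exact h7
        · have := h3.sound.pos_lt_pos h7 hi; omega
      rw [inj hjl hjl' eb, inj (h5.trans hjl) (h5'.trans hjl') ee]

theorem word_single (b : GluingTree) : word (single b) = word b ++ [true] := by
  simp [word, cuts]

theorem flagHead_fst {f : Bool} {p : List ℕ} {m : ℕ} (h : p.length = m + 1) :
    (flagHead f p).map Prod.fst = f :: List.replicate m false := by
  cases p with
  | nil => simp at h
  | cons k ks =>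
    have : ks.length = m := by simpa using h
    simp [flagHead, Function.comp_def, this, List.map_const']

/-- The word of a node depends on the subtrees only through their words. This turns the counting of
trees into a recursion on words. -/
theorem word_node (a : GluingTree) {b : GluingTree} {j l : ℕ} (hj : IsMark (word b) j)
    (hl : l ≤ j) : word (node a b j l) = (word a).dropLast ++
      ((l == 0) :: List.replicate (j - l) false ++ ((word b).drop j ++ [true])) := by
  have hjl : j ≤ b.cuts.length := by simpa [word] using hj.le
  unfold word
  rw [cuts]
  simp only [List.map_append]
  rw [flagHead_fst (m := j - l)]
  · simp [List.map_dropLast, List.map_drop, Function.comp_def]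
  · simp [positions]; omega

theorem Valid.word_eq {x : GluingTree} (h : x.Valid) (h0 : x ≠ nil) :
    x.word = x.word.dropLast ++ [true] := by
  obtain ⟨i, hi⟩ := h.sound.last h0
  simp [word, hi]

/-- Two different cuts need two different heights below the size. In this form the side condition
for `l ≥ 1` is visible in the word. -/
theorem Valid.two_le_size {x : GluingTree} (h : x.Valid) (h0 : x ≠ nil)
    (hw : x.word.dropLast ≠ []) : 2 ≤ x.size := by
  obtain ⟨i, hi⟩ := h.sound.last h0
  have hi0 : i ≠ [] := by
    rintro rfl
    simp [word, hi] at hw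
  obtain ⟨c, i', rfl⟩ := List.exists_cons_of_ne_nil hi0
  have hs := h.sound.sorted
  rw [positions, hi, List.map_append, List.append_assoc, List.pairwise_append] at hs
  have h1 := hs.2.2 c.2 (by simp) (x.size - 1) (by simp)
  omega

end GluingTree

end StackSorting

/-! ### Weighted families of words and their marks -/

namespace StackSorting

open scoped ENNReal

/-- A functional that is given by a weighted family of words. -/
structure IsWeightedSum (F : (List Bool → ℝ≥0∞) → ℝ≥0∞) : Prop where
  tsum : ∀ {ι : Type} (f : ι → List Bool → ℝ≥0∞), F (fun w => ∑' i, f i w) = ∑' i, F (f i)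
  const_mul : ∀ c φ, F (fun w => c * φ w) = c * F φ

namespace IsWeightedSum

variable {F G : (List Bool → ℝ≥0∞) → ℝ≥0∞}

theorem add (hF : IsWeightedSum F) (φ ψ : List Bool → ℝ≥0∞) :
    F (fun w => φ w + ψ w) = F φ + F ψ := by
  have := hF.tsum (fun (b : Bool) w => if b then φ w else ψ w)
  simpa [tsum_bool, add_comm] using this

/-- Additivity suffices, because in `ℝ≥0∞` a larger function is the smaller one plus a truncated
difference. -/
theorem mono (hF : IsWeightedSum F) {φ ψ : List Bool → ℝ≥0∞} (h : ∀ w, φ w ≤ ψ w) :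
    F φ ≤ F ψ := by
  have := hF.add φ (fun w => ψ w - φ w)
  rw [show (fun w => φ w + (ψ w - φ w)) = ψ from funext fun w => add_tsub_cancel_of_le (h w)]
    at this
  rw [this]
  exact le_self_add

theorem zero (hF : IsWeightedSum F) : F (fun _ => 0) = 0 := by
  have := hF.const_mul 0 (fun _ => 0)
  simpa using this

theorem point (w : List Bool) : IsWeightedSum fun φ => φ w := ⟨fun _ => rfl, fun _ _ => rfl⟩

theorem null : IsWeightedSum fun _ => 0 := ⟨fun _ => by simp, fun _ _ => by simp⟩

theorem sum (hF : IsWeightedSum F) (hG : IsWeightedSum G) : IsWeightedSum fun φ => F φ + G φ :=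
  ⟨fun f => by rw [hF.tsum, hG.tsum, ENNReal.tsum_add],
    fun c φ => by rw [hF.const_mul, hG.const_mul, mul_add]⟩

theorem smul (c : ℝ≥0∞) (hF : IsWeightedSum F) : IsWeightedSum fun φ => c * F φ :=
  ⟨fun f => by rw [hF.tsum, ENNReal.tsum_mul_left],
    fun c φ => by rw [hF.const_mul, mul_left_comm]⟩

theorem iSum {ι : Type} {F : ι → (List Bool → ℝ≥0∞) → ℝ≥0∞} (hF : ∀ i, IsWeightedSum (F i)) :
    IsWeightedSum fun φ => ∑' i, F i φ :=
  ⟨fun f => by simp_rw [(hF _).tsum]; rw [ENNReal.tsum_comm],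
    fun c φ => by simp_rw [(hF _).const_mul]; rw [ENNReal.tsum_mul_left]⟩

theorem finsetSum {ι : Type} (s : Finset ι) {F : ι → (List Bool → ℝ≥0∞) → ℝ≥0∞}
    (hF : ∀ i, IsWeightedSum (F i)) : IsWeightedSum fun φ => ∑ i ∈ s, F i φ := by
  classical
  induction s using Finset.induction_on with
  | empty => simpa using null
  | insert a s ha ih => simpa [Finset.sum_insert ha] using (hF a).sum ih

theorem bind (hF : IsWeightedSum F) {G : List Bool → (List Bool → ℝ≥0∞) → ℝ≥0∞}
    (hG : ∀ w, IsWeightedSum (G w)) : IsWeightedSum fun φ => F fun w => G w φ :=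
  ⟨fun f => by simp_rw [(hG _).tsum]; rw [hF.tsum],
    fun c φ => by simp_rw [(hG _).const_mul]; rw [hF.const_mul]⟩

theorem comp (hF : IsWeightedSum F) (g : List Bool → List Bool) :
    IsWeightedSum fun φ => F fun w => φ (g w) := hF.bind fun w => point (g w)

theorem finset_sum (hF : IsWeightedSum F) {ι : Type} (s : Finset ι)
    (f : ι → List Bool → ℝ≥0∞) : F (fun w => ∑ i ∈ s, f i w) = ∑ i ∈ s, F (f i) := by
  classical
  induction s using Finset.induction_on with
  | empty => simpa using hF.zero
  | insert a s ha ih => simp_rw [Finset.sum_insert ha]; rw [hF.add, ih]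

end IsWeightedSum

/-- The sum of `Φ` over the letters `true` of a word; the arguments of `Φ` are the position of the
letter and the rest of the word from this letter on. -/
noncomputable def markSum : List Bool → (ℕ → List Bool → ℝ≥0∞) → ℝ≥0∞
  | [], _ => 0
  | b :: w, Φ => (if b then Φ 0 (b :: w) else 0) + markSum w fun i v => Φ (i + 1) v

/-- As `markSum`, with an additional mark at the end of the word. -/
noncomputable def endMarkSum (w : List Bool) (Φ : ℕ → List Bool → ℝ≥0∞) : ℝ≥0∞ :=
  markSum w Φ + Φ w.length []

theorem markSum_append (u v : List Bool) (Φ : ℕ → List Bool → ℝ≥0∞) :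
    markSum (u ++ v) Φ = markSum u (fun i x => Φ i (x ++ v)) +
      markSum v (fun i x => Φ (u.length + i) x) := by
  induction u generalizing Φ with
  | nil => simp [markSum]
  | cons b u ih =>
    simp only [List.cons_append, markSum, ih, List.length_cons, add_assoc]
    congr 3
    funext i x
    congr 1; omega

theorem markSum_replicate (n : ℕ) (Φ : ℕ → List Bool → ℝ≥0∞) :
    markSum (List.replicate n false) Φ = 0 := by
  induction n generalizing Φ with
  | zero => rfl
  | succ n ih => simp [List.replicate_succ, markSum, ih]

theorem isWeightedSum_markSum (w : List Bool) {G : ℕ → List Bool → (List Bool → ℝ≥0∞) → ℝ≥0∞}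
    (hG : ∀ i v, IsWeightedSum (G i v)) :
    IsWeightedSum fun φ => markSum w fun i v => G i v φ := by
  induction w generalizing G with
  | nil => exact IsWeightedSum.null
  | cons b w ih =>
    refine IsWeightedSum.sum ?_ (ih fun i v => hG (i + 1) v)
    cases b
    · simpa using IsWeightedSum.null
    · simpa using hG 0 (true :: w)

theorem isWeightedSum_endMarkSum (w : List Bool)
    {G : ℕ → List Bool → (List Bool → ℝ≥0∞) → ℝ≥0∞} (hG : ∀ i v, IsWeightedSum (G i v)) :
    IsWeightedSum fun φ => endMarkSum w fun i v => G i v φ :=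
  (isWeightedSum_markSum w hG).sum (hG _ _)

theorem IsWeightedSum.markSum {F : (List Bool → ℝ≥0∞) → ℝ≥0∞} (hF : IsWeightedSum F)
    (w : List Bool) (f : ℕ → List Bool → List Bool → ℝ≥0∞) :
    F (fun u => StackSorting.markSum w fun i v => f i v u) =
      StackSorting.markSum w fun i v => F (f i v) := by
  induction w generalizing f with
  | nil => exact hF.zero
  | cons b w ih =>
    simp only [StackSorting.markSum]
    rw [hF.add, ih]
    cases b
    · simp [hF.zero]
    · simp

theorem markSum_add (w : List Bool) (Φ Ψ : ℕ → List Bool → ℝ≥0∞) :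
    markSum w (fun i v => Φ i v + Ψ i v) = markSum w Φ + markSum w Ψ := by
  induction w generalizing Φ Ψ with
  | nil => simp [markSum]
  | cons b w ih =>
    simp only [markSum, ih]
    cases b
    · simp
    · simp only [if_true]; ring

theorem endMarkSum_add (w : List Bool) (Φ Ψ : ℕ → List Bool → ℝ≥0∞) :
    endMarkSum w (fun i v => Φ i v + Ψ i v) = endMarkSum w Φ + endMarkSum w Ψ := by
  simp only [endMarkSum, markSum_add]; ring

open Classical in
-- This identifies the recursive sum over marks with the sum over the admissible indices `j` of a
-- node.
theorem endMarkSum_eq_tsum (w : List Bool) (Φ : ℕ → List Bool → ℝ≥0∞) :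
    endMarkSum w Φ = ∑' j, if IsMark w j then Φ j (w.drop j) else 0 := by
  induction w generalizing Φ with
  | nil =>
    rw [tsum_eq_single 0]
    · simp [endMarkSum, markSum, IsMark]
    · intro j hj
      cases j with
      | zero => exact (hj rfl).elim
      | succ j => simp [IsMark]
  | cons b w ih =>
    rw [tsum_eq_zero_add' ENNReal.summable]
    have := ih fun i v => Φ (i + 1) v
    simp only [IsMark, List.drop_succ_cons, List.drop_zero]
    rw [← this]
    simp [endMarkSum, markSum, add_assoc]

variable (t : ℝ≥0∞)

/-- The sum over all valid trees. -/
noncomputable def validSum (φ : List Bool → ℝ≥0∞) : ℝ≥0∞ :=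
  ∑' x : {x : GluingTree // x.Valid}, t ^ x.1.size * φ x.1.word

/-- The sum over all valid trees with at least one node. -/
noncomputable def treeSum (φ : List Bool → ℝ≥0∞) : ℝ≥0∞ :=
  ∑' x : {x : GluingTree // x.Valid ∧ x ≠ .nil}, t ^ x.1.size * φ x.1.word

/-- The sum over the words inserted by gluing with `l = 0`. -/
noncomputable def tightSum (φ : List Bool → ℝ≥0∞) : ℝ≥0∞ :=
  t * validSum t fun w => endMarkSum w fun i v => φ (true :: List.replicate i false ++ v)

/-- The sum over the words inserted by gluing with `l ≥ 1`. -/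
noncomputable def looseSum (φ : List Bool → ℝ≥0∞) : ℝ≥0∞ :=
  t * validSum t fun w => endMarkSum w fun i v =>
    ∑ s ∈ Finset.range i, φ (List.replicate (s + 1) false ++ v)

/-- The sum over the words inserted by gluing. -/
noncomputable def pieceSum (φ : List Bool → ℝ≥0∞) : ℝ≥0∞ := tightSum t φ + looseSum t φ

/-- The sum over concatenations of `n` inserted words. -/
noncomputable def piecePow : ℕ → (List Bool → ℝ≥0∞) → ℝ≥0∞
  | 0, φ => φ []
  | n + 1, φ => pieceSum t fun u => piecePow n fun v => φ (u ++ v)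

/-- The sum over blocks: sequences of inserted words that are closed by a letter `true`. -/
noncomputable def blockSum (φ : List Bool → ℝ≥0∞) : ℝ≥0∞ :=
  t * ∑' n, piecePow t n fun u => φ (u ++ [true])

/-- The sum over blocks that begin with the letter `true`, followed by `k` arbitrary blocks. -/
noncomputable def restSum : ℕ → (List Bool → ℝ≥0∞) → ℝ≥0∞
  | 0, φ => t * φ [true] + tightSum t fun u => blockSum t fun v => φ (u ++ v)
  | k + 1, φ => restSum k fun u => blockSum t fun v => φ (u ++ v)

theorem isWeightedSum_validSum : IsWeightedSum (validSum t) :=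
  IsWeightedSum.iSum fun _ => (IsWeightedSum.point _).smul _

theorem isWeightedSum_treeSum : IsWeightedSum (treeSum t) :=
  IsWeightedSum.iSum fun _ => (IsWeightedSum.point _).smul _

theorem isWeightedSum_tightSum : IsWeightedSum (tightSum t) :=
  ((isWeightedSum_validSum t).bind fun w => isWeightedSum_endMarkSum w fun _ _ =>
    IsWeightedSum.point _).smul t

theorem isWeightedSum_looseSum : IsWeightedSum (looseSum t) :=
  ((isWeightedSum_validSum t).bind fun w => isWeightedSum_endMarkSum w fun _ _ =>
    IsWeightedSum.finsetSum _ fun _ => IsWeightedSum.point _).smul t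

theorem isWeightedSum_pieceSum : IsWeightedSum (pieceSum t) :=
  (isWeightedSum_tightSum t).sum (isWeightedSum_looseSum t)

theorem isWeightedSum_piecePow (n : ℕ) : IsWeightedSum (piecePow t n) := by
  induction n with
  | zero => exact IsWeightedSum.point []
  | succ n ih => exact (isWeightedSum_pieceSum t).bind fun u => ih.comp (u ++ ·)

theorem isWeightedSum_blockSum : IsWeightedSum (blockSum t) :=
  (IsWeightedSum.iSum fun n => (isWeightedSum_piecePow t n).comp (· ++ [true])).smul t

theorem isWeightedSum_restSum (k : ℕ) : IsWeightedSum (restSum t k) := by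
  induction k with
  | zero => exact ((IsWeightedSum.point _).smul t).sum ((isWeightedSum_tightSum t).bind fun u =>
      (isWeightedSum_blockSum t).comp (u ++ ·))
  | succ k ih => exact ih.bind fun u => (isWeightedSum_blockSum t).comp (u ++ ·)

/-- A block is the letter `true` alone, or a first piece followed by a block. -/
theorem blockSum_eq (φ : List Bool → ℝ≥0∞) :
    blockSum t φ = t * φ [true] + pieceSum t fun u => blockSum t fun v => φ (u ++ v) := by
  have h := (isWeightedSum_pieceSum t)
  unfold blockSum
  rw [h.const_mul, h.tsum, tsum_eq_zero_add' ENNReal.summable, mul_add]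
  simp [piecePow]

end StackSorting

/-! ### Decomposition of trees at the root -/

namespace StackSorting

open scoped ENNReal

variable (t : ℝ≥0∞)

open Classical in
theorem validSum_eq_tsum (φ : List Bool → ℝ≥0∞) :
    validSum t φ = ∑' x : GluingTree, if x.Valid then t ^ x.size * φ x.word else 0 := by
  refine (tsum_subtype {x : GluingTree | x.Valid} fun x => t ^ x.size * φ x.word).trans ?_
  simp [Set.indicator]

open Classical in
theorem treeSum_eq_tsum (φ : List Bool → ℝ≥0∞) :
    treeSum t φ =
      ∑' x : GluingTree, if x.Valid ∧ x ≠ .nil then t ^ x.size * φ x.word else 0 := by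
  refine (tsum_subtype {x : GluingTree | x.Valid ∧ x ≠ .nil}
    fun x => t ^ x.size * φ x.word).trans ?_
  simp [Set.indicator]

theorem add_treeSum_le_validSum (φ : List Bool → ℝ≥0∞) : φ [] + treeSum t φ ≤ validSum t φ := by
  classical
  rw [validSum_eq_tsum, treeSum_eq_tsum]
  have h : φ [] = ∑' x : GluingTree, if x = .nil then φ [] else 0 := by simp
  rw [h, ← ENNReal.tsum_add]
  refine ENNReal.tsum_le_tsum fun x => ?_
  by_cases hx : x = .nil
  · subst hx; simp [GluingTree.Valid, GluingTree.size, GluingTree.word, GluingTree.cuts]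
  · simp [hx]

theorem tsum_single_add_tsum_node_le (h : GluingTree → ℝ≥0∞) :
    ∑' b, h (.single b) + ∑' a, ∑' b, ∑' j, ∑' l, h (.node a b j l) ≤ ∑' x, h x := by
  let f : GluingTree ⊕ GluingTree × GluingTree × ℕ × ℕ → GluingTree :=
    Sum.elim .single fun p => .node p.1 p.2.1 p.2.2.1 p.2.2.2
  have hf : Function.Injective f := by
    rintro (x | ⟨a, b, c, d⟩) (y | ⟨a', b', c', d'⟩) h <;> simp_all [f]
  refine le_trans (le_of_eq ?_) (ENNReal.tsum_comp_le_tsum_of_injective hf h)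
  rw [Summable.tsum_sum ENNReal.summable ENNReal.summable]
  simp only [f, Sum.elim_inl, Sum.elim_inr]
  congr 1
  simp_rw [ENNReal.tsum_prod']

/-- A tree with at least one node is `single b` or `node a b j l`; the words are written without
their last letter, which is `true`. -/
theorem le_treeSum_dropLast (φ : List Bool → ℝ≥0∞) :
    t * validSum t φ + treeSum t (fun w => (tightSum t fun p => φ (w.dropLast ++ p)) +
      if w.dropLast = [] then 0 else looseSum t fun p => φ (w.dropLast ++ p)) ≤
    treeSum t fun w => φ w.dropLast := by
  classical
  rw [treeSum_eq_tsum t fun w => φ w.dropLast]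
  refine le_trans (add_le_add (le_of_eq ?_) ?_) (tsum_single_add_tsum_node_le _)
  · rw [validSum_eq_tsum, ← ENNReal.tsum_mul_left]
    congr 1
    funext b
    have : (GluingTree.single b).Valid ↔ b.Valid := Iff.rfl
    by_cases hb : b.Valid
    · simp [this, hb, GluingTree.word_single, GluingTree.size]
      ring
    · simp [this, hb]
  rw [treeSum_eq_tsum]
  refine ENNReal.tsum_le_tsum fun a => ?_
  by_cases ha : a.Valid ∧ a ≠ .nil
  swap
  · simp [ha]
  rw [if_pos ha]
  have e : (tightSum t fun p => φ (a.word.dropLast ++ p)) +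
      (if a.word.dropLast = [] then 0 else looseSum t fun p => φ (a.word.dropLast ++ p)) =
      t * validSum t fun w => endMarkSum w fun i v =>
        φ (a.word.dropLast ++ (true :: List.replicate i false ++ v)) +
        if a.word.dropLast = [] then 0 else
          ∑ s ∈ Finset.range i, φ (a.word.dropLast ++ (List.replicate (s + 1) false ++ v)) := by
    by_cases h : a.word.dropLast = []
    · simp [h, tightSum]
    · simp only [h, if_false, endMarkSum_add]
      rw [(isWeightedSum_validSum t).add, mul_add]
      rfl
  rw [e, validSum_eq_tsum, ← ENNReal.tsum_mul_left, ← ENNReal.tsum_mul_left]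
  refine ENNReal.tsum_le_tsum fun b => ?_
  by_cases hb : b.Valid
  swap
  · simp [hb]
  rw [if_pos hb, endMarkSum_eq_tsum, ← ENNReal.tsum_mul_left, ← ENNReal.tsum_mul_left,
    ← ENNReal.tsum_mul_left]
  refine ENNReal.tsum_le_tsum fun j => ?_
  by_cases hj : IsMark b.word j
  swap
  · simp [hj]
  rw [if_pos hj]
  -- Only `l ≤ j` is admissible. The term `l = 0` gives the tight piece; the terms with `l ≥ 1` give
  -- the loose ones.
  refine le_trans ?_ (ENNReal.sum_le_tsum (Finset.range (j + 1)))
  have c : ∀ l, t ^ (GluingTree.node a b j l).size = t ^ a.size * (t * t ^ b.size) := by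
    intro l; simp only [GluingTree.size]; ring
  have d : ∀ l ≤ j, (GluingTree.node a b j l).word.dropLast = a.word.dropLast ++
      ((l == 0) :: (List.replicate (j - l) false ++ b.word.drop j)) := by
    intro l hl
    rw [GluingTree.word_node a hj hl, show a.word.dropLast ++ ((l == 0) ::
      List.replicate (j - l) false ++ (b.word.drop j ++ [true])) = (a.word.dropLast ++
      ((l == 0) :: (List.replicate (j - l) false ++ b.word.drop j))) ++ [true] by simp,
      List.dropLast_concat]
  have v : ∀ l ≤ j, (l = 0 ∨ 2 ≤ a.size) →
      (GluingTree.node a b j l).Valid ∧ GluingTree.node a b j l ≠ .nil := fun l hl h =>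
    ⟨⟨ha.1, ha.2, hb, hj, hl, h⟩, by simp⟩
  rw [Finset.sum_range_succ', if_pos (v 0 (by omega) (Or.inl rfl)), c, d 0 (by omega),
    add_comm (φ _)]
  simp only [mul_add]
  refine add_le_add ?_ (le_of_eq ?_)
  · split_ifs with h
    · simp
    have h2 := ha.1.two_le_size ha.2 h
    -- A loose piece has `j - l + 1` letters `false` in front, so `s` stands for `j - l`; reflecting
    -- the range turns it into `l - 1`.
    rw [← Finset.sum_range_reflect, Finset.mul_sum, Finset.mul_sum, Finset.mul_sum]
    refine Finset.sum_le_sum fun s hs => le_of_eq ?_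
    rw [Finset.mem_range] at hs
    rw [if_pos (v _ (by omega) (Or.inr h2)), c, d _ (by omega)]
    rw [show j - (s + 1) = j - 1 - s from by omega]
    simp [List.replicate_succ, mul_assoc]
  · simp [mul_assoc]

end StackSorting

/-! ### Blocks, the divergence criterion and sums over marks -/

namespace StackSorting

open scoped ENNReal

variable (t : ℝ≥0∞)

theorem le_treeSum_of_single_nil (φ : List Bool → ℝ≥0∞) : t * φ [true] ≤ treeSum t φ := by
  refine le_trans (le_of_eq ?_) (ENNReal.le_tsum ⟨.single .nil, trivial, by simp⟩)
  simp [GluingTree.size, GluingTree.word, GluingTree.cuts]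

theorem treeSum_congr {φ ψ : List Bool → ℝ≥0∞} (h : ∀ w, φ (w ++ [true]) = ψ (w ++ [true])) :
    treeSum t φ = treeSum t ψ := by
  unfold treeSum
  congr 1
  funext x
  rw [x.2.1.word_eq x.2.2, h]

/-- The sum over all valid trees whose word has at least two letters; the last letter is
dropped. -/
noncomputable def longSum (φ : List Bool → ℝ≥0∞) : ℝ≥0∞ :=
  treeSum t fun w => if w.dropLast = [] then 0 else φ w.dropLast

theorem add_longSum_le (φ : List Bool → ℝ≥0∞) :
    t * φ [] + longSum t φ ≤ treeSum t fun w => φ w.dropLast := by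
  have h : (treeSum t fun w => φ w.dropLast) =
      (treeSum t fun w => if w.dropLast = [] then φ [] else 0) + longSum t φ := by
    rw [longSum, ← (isWeightedSum_treeSum t).add]
    congr 1
    funext w
    split_ifs with hw <;> simp [hw]
  rw [h]
  refine add_le_add_left ?_ _
  exact le_treeSum_of_single_nil t fun w => if w.dropLast = [] then φ [] else 0

/-- Words with at least two letters arise from `single b` with `b` nonempty, from a tight gluing
onto the one-node tree, or from any gluing onto a tree that already has such a word. Separating the
one-node tree isolates the only place where loose gluing is excluded. -/
theorem le_longSum (φ : List Bool → ℝ≥0∞) :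
    t * treeSum t φ + t * tightSum t φ +
      longSum t (fun w => pieceSum t fun p => φ (w ++ p)) ≤ longSum t φ := by
  set ψ : List Bool → ℝ≥0∞ := fun w => if w = [] then 0 else φ w with hψ
  have h1 : treeSum t φ ≤ validSum t ψ := by
    refine le_trans (le_of_eq ?_) (le_trans le_add_self (add_treeSum_le_validSum t ψ))
    exact treeSum_congr t fun w => by simp [hψ]
  have h2 : ∀ w, (tightSum t fun p => ψ (w ++ p)) = tightSum t fun p => φ (w ++ p) := by
    intro w; simp [tightSum, hψ]
  have h3 : longSum t φ = treeSum t fun w => ψ w.dropLast := rfl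
  rw [h3, add_assoc]
  refine le_trans (add_le_add (mul_le_mul_right h1 t) ?_) (le_treeSum_dropLast t ψ)
  refine le_trans (add_longSum_le t fun w => (tightSum t fun p => φ (w ++ p)) +
    if w = [] then 0 else looseSum t fun p => φ (w ++ p)) ?_ |> le_trans ?_
  · refine add_le_add ?_ ?_
    · simp
    · refine (isWeightedSum_treeSum t).mono fun w => ?_
      split_ifs with hw
      · exact le_rfl
      · simp [pieceSum, hw]
  · refine (isWeightedSum_treeSum t).mono fun w => ?_
    rw [h2]
    split_ifs with hw
    · exact le_rfl
    · simp [hψ, hw]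

/-- Iterating `le_longSum` strips off pieces until a `single b` is reached. If `b` is nonempty, its
word is followed by a block; if `b` is empty, the first piece must be tight, which is `restSum t 0`.
The partial sums over the number of pieces are bounded uniformly. -/
theorem restSum_zero_add_le (φ : List Bool → ℝ≥0∞) :
    restSum t 0 φ + treeSum t (fun w => blockSum t fun v => φ (w ++ v)) ≤ treeSum t φ := by
  have h1 : treeSum t φ = treeSum t fun w => φ (w.dropLast ++ [true]) :=
    treeSum_congr t fun w => by simp
  have h2 : ∀ (N : ℕ) (φ : List Bool → ℝ≥0∞), ∑ n ∈ Finset.range N,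
      (t * treeSum t (fun w => piecePow t n fun u => φ (w ++ u)) +
        t * tightSum t (fun w => piecePow t n fun u => φ (w ++ u))) +
      longSum t (fun w => piecePow t N fun u => φ (w ++ u)) ≤ longSum t φ := by
    intro N φ
    induction N with
    | zero => simp [piecePow]
    | succ N ih =>
      refine le_trans ?_ ih
      rw [Finset.sum_range_succ, add_assoc]
      refine add_le_add_right ?_ _
      refine le_trans (le_of_eq ?_)
        (le_longSum t fun w => piecePow t N fun u => φ (w ++ u))
      simp only [piecePow, List.append_assoc]
  rw [h1]
  refine le_trans ?_ (add_longSum_le t fun w => φ (w ++ [true]))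
  rw [restSum, add_assoc]
  refine add_le_add_right ?_ _
  have h3 : ∀ {F : (List Bool → ℝ≥0∞) → ℝ≥0∞}, IsWeightedSum F →
      F (fun w => blockSum t fun v => φ (w ++ v)) =
        ∑' n, t * F fun w => piecePow t n fun u => φ (w ++ u ++ [true]) := by
    intro F hF
    simp only [blockSum]
    rw [hF.const_mul, hF.tsum, ENNReal.tsum_mul_left]
    simp only [List.append_assoc]
  rw [h3 (isWeightedSum_tightSum t), h3 (isWeightedSum_treeSum t), ← ENNReal.tsum_add,
    ENNReal.tsum_eq_iSup_nat]
  refine iSup_le fun N => le_trans ?_ (h2 N fun w => φ (w ++ [true]))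
  refine le_trans (le_of_eq ?_) le_self_add
  exact Finset.sum_congr rfl fun n _ => add_comm _ _

theorem sum_restSum_le_treeSum (n : ℕ) (φ : List Bool → ℝ≥0∞) :
    ∑ k ∈ Finset.range n, restSum t k φ ≤ treeSum t φ := by
  induction n generalizing φ with
  | zero => simp
  | succ n ih =>
    rw [Finset.sum_range_succ', add_comm]
    refine le_trans (add_le_add_right ?_ _) (restSum_zero_add_le t φ)
    exact ih fun w => blockSum t fun v => φ (w ++ v)

/-- With pieces of total weight at least 1, sequences of `n` pieces have weight at least 1 for every
`n`, so the blocks already have infinite weight. -/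
theorem treeSum_eq_top (ht : t ≠ 0) (h : 1 ≤ pieceSum t fun _ => 1) :
    treeSum t (fun _ => 1) = ⊤ := by
  have h1 : ∀ n, 1 ≤ piecePow t n fun _ => 1 := by
    intro n
    induction n with
    | zero => exact le_rfl
    | succ n ih => exact le_trans h ((isWeightedSum_pieceSum t).mono fun _ => ih)
  have h2 : (blockSum t fun _ => 1) = ⊤ := by
    rw [blockSum, eq_top_iff]
    refine le_trans (le_of_eq ?_) (mul_le_mul_right (ENNReal.tsum_le_tsum h1) t)
    rw [ENNReal.tsum_const_eq_top_of_ne_zero one_ne_zero, ENNReal.mul_top ht]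
  have h3 := le_treeSum_of_single_nil t fun _ => ⊤
  rw [ENNReal.mul_top ht, top_le_iff] at h3
  have h4 := restSum_zero_add_le t fun _ => 1
  simp only [h2, h3, add_top, top_le_iff] at h4
  exact h4

/-- As `tightSum` of `markSum`, without the first letter. -/
noncomputable def tightMarkSum (Φ : ℕ → List Bool → ℝ≥0∞) : ℝ≥0∞ :=
  t * validSum t fun w => endMarkSum w fun i v => markSum v fun j x => Φ (i + 1 + j) x

noncomputable def looseMarkSum (Φ : ℕ → List Bool → ℝ≥0∞) : ℝ≥0∞ :=
  t * validSum t fun w => endMarkSum w fun i v =>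
    ∑ s ∈ Finset.range i, markSum v fun j x => Φ (s + 1 + j) x

/-- Append a block. -/
noncomputable def appendBlock (Φ : ℕ → List Bool → ℝ≥0∞) (i : ℕ) (v : List Bool) : ℝ≥0∞ :=
  blockSum t fun x => Φ i (v ++ x)

theorem tightSum_markSum (Φ : ℕ → List Bool → ℝ≥0∞) :
    (tightSum t fun w => markSum w Φ) = tightSum t (Φ 0) + tightMarkSum t Φ := by
  rw [tightSum, tightSum, tightMarkSum, ← mul_add, ← (isWeightedSum_validSum t).add]
  simp only [← endMarkSum_add, List.cons_append, markSum, markSum_append, markSum_replicate,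
    List.length_replicate, if_true, zero_add, add_right_comm]

theorem looseSum_markSum (Φ : ℕ → List Bool → ℝ≥0∞) :
    (looseSum t fun w => markSum w Φ) = looseMarkSum t Φ := by
  simp only [looseSum, looseMarkSum, markSum_append, markSum_replicate, List.length_replicate,
    zero_add]

theorem blockSum_markSum_append (u : List Bool) (Φ : ℕ → List Bool → ℝ≥0∞) :
    (blockSum t fun v => markSum (u ++ v) Φ) = markSum u (appendBlock t Φ) +
      blockSum t fun v => markSum v fun i x => Φ (u.length + i) x := by
  simp only [markSum_append]
  rw [(isWeightedSum_blockSum t).add, (isWeightedSum_blockSum t).markSum]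
  rfl

/-- A mark at the start of the block leaves a rest described by `restSum t 0`. A mark inside the
first piece leaves a rest of that piece followed by a block, and otherwise the mark lies in the
block after the first piece. -/
theorem blockSum_markSum (Φ : ℕ → List Bool → ℝ≥0∞) :
    (blockSum t fun w => markSum w Φ) = restSum t 0 (Φ 0) +
      (tightMarkSum t (appendBlock t Φ) + looseMarkSum t (appendBlock t Φ)) +
      pieceSum t fun u => blockSum t fun v => markSum v fun i x => Φ (u.length + i) x := by
  rw [blockSum_eq]
  simp only [blockSum_markSum_append]
  rw [(isWeightedSum_pieceSum t).add, ← add_assoc]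
  congr 1
  rw [pieceSum, tightSum_markSum, looseSum_markSum, restSum]
  simp only [markSum, if_true, add_zero, add_assoc]
  rfl

theorem restSum_zero_markSum (Φ : ℕ → List Bool → ℝ≥0∞) :
    (restSum t 0 fun w => markSum w Φ) = restSum t 0 (Φ 0) + tightMarkSum t (appendBlock t Φ) +
      tightSum t fun u => blockSum t fun v => markSum v fun i x => Φ (u.length + i) x := by
  simp only [restSum, blockSum_markSum_append]
  rw [(isWeightedSum_tightSum t).add, tightSum_markSum]
  simp only [markSum, if_true, add_zero, add_assoc]
  rfl

theorem restSum_succ_markSum (k : ℕ) (Φ : ℕ → List Bool → ℝ≥0∞) :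
    (restSum t (k + 1) fun w => markSum w Φ) = (restSum t k fun w => markSum w (appendBlock t Φ)) +
      restSum t k fun u => blockSum t fun v => markSum v fun i x => Φ (u.length + i) x := by
  simp only [restSum, blockSum_markSum_append]
  rw [(isWeightedSum_restSum t k).add]

end StackSorting

/-! ### Polynomials packed into integers -/

namespace StackSorting

open scoped ENNReal
open Polynomial

/-- A polynomial with natural coefficients, given by its value `N` at a large number, an upper bound
`s` for the sum of its coefficients and an upper bound `d` for its degree. -/
structure Packed where
  N : ℕ
  s : ℕ
  d : ℕ

namespace Packed

/-- The number at which polynomials are evaluated. -/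
def base : ℕ := 2 ^ 100

def add (a b : Packed) : Packed := ⟨Nat.add a.N b.N, Nat.add a.s b.s, Nat.add a.d b.d⟩

def mul (a b : Packed) : Packed := ⟨Nat.mul a.N b.N, Nat.mul a.s b.s, Nat.add a.d b.d⟩

def const (c : ℕ) : Packed := ⟨c, c, 0⟩

def zero : Packed := ⟨0, 0, 0⟩

/-- Multiply the digits by `u / v`, and round down; digits from index `n` on are collected at
index `n`. -/
def scaleDigits (u v : ℕ) : ℕ → ℕ → ℕ
  | 0, N => Nat.div (Nat.mul (Nat.mod N (Nat.pred base)) u) v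
  | n + 1, N => Nat.add (Nat.div (Nat.mul (Nat.mod N base) u) v)
      (Nat.mul base (scaleDigits u v n (Nat.div N base)))

/-- Evaluate `x` before `k` is called. -/
def force {α : Type} (x : ℕ) (k : ℕ → α) : α := Nat.rec (k 0) (fun n _ => k n.succ) x

/-- The largest exponent that is kept. -/
def maxDegree : ℕ := 20

/-- The test guarantees that the value at 1 is below `base - 1`, so digits do not overflow.
Otherwise `zero` is returned, which is always a valid lower bound. -/
def scale (u v : ℕ) (a : Packed) : Packed :=
  match Nat.ble base (Nat.succ a.s) with
  | true => zero
  | false => force (scaleDigits u v maxDegree a.N) fun N => ⟨N, Nat.mod N (Nat.pred base), maxDegree⟩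

/-- Multiply by the indeterminate `X`. -/
def shift (a : Packed) : Packed := ⟨Nat.mul base a.N, a.s, Nat.succ a.d⟩

/-- Replace `X ^ n` by `X + X ^ 2 + ⋯ + X ^ n`. -/
def spread (a : Packed) : Packed :=
  match Nat.ble base (Nat.succ a.s) with
  | true => zero
  | false => ⟨Nat.mul base (Nat.div a.N (Nat.pred base)), Nat.mul a.s a.d, Nat.succ a.d⟩

def forcePacked {α : Type} (a : Packed) (k : Packed → α) : α :=
  force a.N fun N => force a.s fun s => force a.d fun d => k ⟨N, s, d⟩

def forceList {α : Type} : List Packed → (List Packed → α) → α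
  | [], k => k []
  | x :: l, k => x.forcePacked fun x => forceList l fun l => k (x :: l)

def addList : List Packed → List Packed → List Packed
  | [], q => q
  | x :: p, [] => x :: p
  | x :: p, y :: q => x.add y :: addList p q

def mulList (a : Packed) (l : List Packed) : List Packed := l.map a.mul

/-- The number of entries that are kept in a list. -/
def maxLength : ℕ := 7

def scaleList (u v : ℕ) (l : List Packed) : List Packed := (l.take maxLength).map (scale u v)

def sum (l : List Packed) : Packed := l.foldr add zero

def sumList (l : List (List Packed)) : List Packed := l.foldr addList []

theorem force_eq {α : Type} (x : ℕ) (k : ℕ → α) : force x k = k x := by cases x <;> rfl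

theorem forcePacked_eq {α : Type} (a : Packed) (k : Packed → α) : a.forcePacked k = k a := by
  simp only [forcePacked, force_eq]

theorem forceList_eq {α : Type} (l : List Packed) (k : List Packed → α) :
    forceList l k = k l := by
  induction l generalizing k with
  | nil => rfl
  | cons x l ih => simp only [forceList, forcePacked_eq, ih]

/-- `a` describes the polynomial `p`. -/
structure Rep (p : ℕ[X]) (a : Packed) : Prop where
  eval_base : p.eval base = a.N
  eval_one_le : p.eval 1 ≤ a.s
  natDegree_le : p.natDegree ≤ a.d

/-- Substitute `φ n` for `X ^ n`. -/
noncomputable def pairing (p : ℕ[X]) (φ : ℕ → ℝ≥0∞) : ℝ≥0∞ := p.sum fun n c => c * φ n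

theorem pairing_add (p q : ℕ[X]) (φ : ℕ → ℝ≥0∞) : pairing (p + q) φ = pairing p φ + pairing q φ :=
  Polynomial.sum_add_index _ _ _ (by simp) (by intros; push_cast; ring)

theorem pairing_monomial (n c : ℕ) (φ : ℕ → ℝ≥0∞) : pairing (monomial n c) φ = c * φ n :=
  Polynomial.sum_monomial_index _ _ (by simp)

theorem pairing_zero (φ : ℕ → ℝ≥0∞) : pairing 0 φ = 0 := Polynomial.sum_zero_index _

theorem pairing_C (c : ℕ) (φ : ℕ → ℝ≥0∞) : pairing (C c) φ = c * φ 0 := pairing_monomial 0 c φ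

theorem pairing_mul (p q : ℕ[X]) (φ : ℕ → ℝ≥0∞) :
    pairing (p * q) φ = pairing p fun i => pairing q fun j => φ (i + j) := by
  induction p using Polynomial.induction_on' with
  | add p p' h h' => rw [add_mul, pairing_add, pairing_add, h, h']
  | monomial n c =>
    rw [pairing_monomial]
    induction q using Polynomial.induction_on' with
    | add p p' h h' => rw [mul_add, pairing_add, pairing_add, h, h', mul_add]
    | monomial m d =>
      rw [monomial_mul_monomial, pairing_monomial, pairing_monomial]
      push_cast; ring

theorem pairing_X_mul (p : ℕ[X]) (φ : ℕ → ℝ≥0∞) :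
    pairing (X * p) φ = pairing p fun i => φ (i + 1) := by
  rw [mul_comm, pairing_mul, ← monomial_one_one_eq_X]
  simp [pairing_monomial]

theorem pairing_mono (p : ℕ[X]) {φ ψ : ℕ → ℝ≥0∞} (h : ∀ n, φ n ≤ ψ n) : pairing p φ ≤ pairing p ψ :=
  Finset.sum_le_sum fun n _ => mul_le_mul_right (h n) _

theorem pairing_const_mul (p : ℕ[X]) (c : ℝ≥0∞) (φ : ℕ → ℝ≥0∞) :
    pairing p (fun n => c * φ n) = c * pairing p φ := by
  simp only [pairing, Polynomial.sum, Finset.mul_sum]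
  exact Finset.sum_congr rfl fun n _ => mul_left_comm _ _ _

theorem pairing_tsum (p : ℕ[X]) (f : ℕ → ℕ → ℝ≥0∞) :
    pairing p (fun n => ∑' k, f k n) = ∑' k, pairing p (f k) := by
  simp only [pairing, Polynomial.sum, ← ENNReal.tsum_mul_left]
  exact (Summable.tsum_finsetSum fun _ _ => ENNReal.summable).symm

theorem pairing_const (p : ℕ[X]) (c : ℝ≥0∞) : pairing p (fun _ => c) = (p.eval 1 : ℕ) * c := by
  rw [eval_eq_sum]
  simp [pairing, Polynomial.sum, Finset.sum_mul]

theorem pairing_eq_divX (p : ℕ[X]) (φ : ℕ → ℝ≥0∞) :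
    pairing p φ = p.coeff 0 * φ 0 + pairing p.divX fun n => φ (n + 1) := by
  conv_lhs => rw [← divX_mul_X_add p, pairing_add, pairing_C, mul_comm, pairing_X_mul, add_comm]

theorem eval_eq_divX (p : ℕ[X]) (x : ℕ) : p.eval x = p.coeff 0 + x * p.divX.eval x := by
  conv_lhs => rw [← divX_mul_X_add p]
  simp [add_comm, mul_comm]

/-- Replace `X ^ n` by `1 + X + ⋯ + X ^ (n - 1)`. -/
noncomputable def spreadPoly (p : ℕ[X]) : ℕ[X] :=
  p.sum fun n c => C c * ∑ i ∈ Finset.range n, X ^ i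

theorem spreadPoly_add (p q : ℕ[X]) : spreadPoly (p + q) = spreadPoly p + spreadPoly q :=
  Polynomial.sum_add_index _ _ _ (by simp) (by intros; rw [C_add, add_mul])

theorem spreadPoly_monomial (n c : ℕ) :
    spreadPoly (monomial n c) = C c * ∑ i ∈ Finset.range n, X ^ i :=
  Polynomial.sum_monomial_index _ _ (by simp)

/-- The identity B^n = 1 + (B - 1)(1 + B + ⋯ + B^(n-1)), extended linearly. Division of the packed
number by `base - 1` therefore yields the spread polynomial as quotient and the value at 1 as
remainder, if the latter is small enough. -/
theorem eval_eq_spreadPoly (p : ℕ[X]) :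
    p.eval base = p.eval 1 + base.pred * (spreadPoly p).eval base := by
  induction p using Polynomial.induction_on' with
  | add p q h h' => simp only [spreadPoly_add, eval_add, h, h']; ring
  | monomial n c =>
    rw [spreadPoly_monomial]
    simp only [eval_monomial, eval_mul, eval_C, eval_finsetSum, eval_pow, eval_X, one_pow]
    have h : base ^ n = 1 + base.pred * ∑ i ∈ Finset.range n, base ^ i := by
      have h := geom_sum_mul_add base.pred n
      rw [show base.pred + 1 = base from Nat.succ_pred (by norm_num [base])] at h
      rw [← h]; ring
    rw [h]; ring

theorem eval_base_mod (p : ℕ[X]) : p.eval base % base.pred = p.eval 1 % base.pred := by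
  rw [eval_eq_spreadPoly, Nat.add_mul_mod_self_left]

/-- The polynomial version of `scaleDigits`. -/
noncomputable def scalePoly (u v : ℕ) : ℕ → ℕ[X] → ℕ[X]
  | 0, p => C (p.eval 1 * u / v)
  | n + 1, p => C (p.coeff 0 * u / v) + X * scalePoly u v n p.divX

theorem eval_scalePoly (u v n : ℕ) (p : ℕ[X]) (hp : p.eval 1 < base.pred) :
    (scalePoly u v n p).eval base = scaleDigits u v n (p.eval base) := by
  induction n generalizing p with
  | zero =>
    change _ = p.eval base % base.pred * u / v
    rw [eval_base_mod, Nat.mod_eq_of_lt hp, scalePoly, eval_C]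
  | succ n ih =>
    have h := eval_eq_divX p 1
    have h0 : p.coeff 0 < base := lt_of_le_of_lt (by omega) (hp.trans_le (Nat.pred_le _))
    change _ = p.eval base % base * u / v + base * scaleDigits u v n (p.eval base / base)
    rw [eval_eq_divX p base, Nat.add_mul_mod_self_left, Nat.mod_eq_of_lt h0,
      Nat.add_mul_div_left _ _ (by norm_num [base]), Nat.div_eq_of_lt h0, zero_add,
      ← ih _ (by omega)]
    simp [scalePoly]

theorem eval_one_scalePoly_le {u v : ℕ} (huv : u ≤ v) (n : ℕ) (p : ℕ[X]) :
    (scalePoly u v n p).eval 1 ≤ p.eval 1 := by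
  have h : ∀ x, x * u / v ≤ x := fun x =>
    Nat.div_le_of_le_mul (by rw [mul_comm v]; exact Nat.mul_le_mul_left x huv)
  induction n generalizing p with
  | zero => simpa [scalePoly] using h _
  | succ n ih =>
    rw [eval_eq_divX p]
    simpa [scalePoly] using add_le_add (h _) (ih _)

theorem natDegree_scalePoly_le (u v n : ℕ) (p : ℕ[X]) : (scalePoly u v n p).natDegree ≤ n := by
  induction n generalizing p with
  | zero => simp [scalePoly]
  | succ n ih =>
    refine (natDegree_add_le _ _).trans (max_le (by simp) ?_)
    refine natDegree_mul_le.trans ?_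
    have := ih p.divX
    simp only [natDegree_X]; omega

/-- Rounding down loses weight. Collecting high exponents at index `n` lowers the exponents, which
is why `φ` has to be monotone. -/
theorem mul_pairing_scalePoly_le (u v n : ℕ) (p : ℕ[X]) {φ : ℕ → ℝ≥0∞} (hφ : Monotone φ) :
    v * pairing (scalePoly u v n p) φ ≤ u * pairing p φ := by
  have h : ∀ (x : ℕ) (c : ℝ≥0∞), v * (((x * u / v : ℕ) : ℝ≥0∞) * c) ≤ u * (x * c) := by
    intro x c
    rw [← mul_assoc, ← mul_assoc]
    refine mul_le_mul_left ?_ c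
    norm_cast
    rw [mul_comm u]
    exact Nat.mul_div_le _ _
  induction n generalizing p φ with
  | zero =>
    rw [scalePoly, pairing_C]
    refine (h _ _).trans (mul_le_mul_right ?_ _)
    rw [← pairing_const]
    exact pairing_mono p fun n => hφ (Nat.zero_le n)
  | succ n ih =>
    rw [scalePoly, pairing_add, pairing_C, pairing_X_mul, pairing_eq_divX p, mul_add, mul_add]
    exact add_le_add (h _ _) (ih _ fun a b hab => hφ (Nat.succ_le_succ hab))

theorem pairing_one_mod_le (p : ℕ[X]) {a : Packed} (h : Rep p a) :
    ((Nat.mod a.N (Nat.pred base) : ℕ) : ℝ≥0∞) ≤ pairing p fun _ => 1 := by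
  rw [pairing_const, mul_one, ← h.eval_base]
  norm_cast
  exact (eval_base_mod p).trans_le (Nat.mod_le _ _)

theorem pairing_spreadPoly (p : ℕ[X]) (φ : ℕ → ℝ≥0∞) :
    pairing (X * spreadPoly p) φ = pairing p fun i => ∑ s ∈ Finset.range i, φ (s + 1) := by
  induction p using Polynomial.induction_on' with
  | add p q h h' => simp only [spreadPoly_add, mul_add, pairing_add, h, h']
  | monomial n c =>
    rw [spreadPoly_monomial, pairing_monomial, pairing_X_mul, pairing_mul, pairing_C]
    congr 1
    induction n with
    | zero => simp [pairing_zero]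
    | succ n ih =>
      rw [Finset.sum_range_succ, Finset.sum_range_succ, pairing_add, ih, ← monomial_one_right_eq_X_pow,
        pairing_monomial]
      simp

theorem eval_one_spreadPoly_le (p : ℕ[X]) {d : ℕ} (h : p.natDegree ≤ d) :
    (spreadPoly p).eval 1 ≤ p.eval 1 * d := by
  rw [spreadPoly, Polynomial.sum, eval_finsetSum, eval_eq_sum, Polynomial.sum, Finset.sum_mul]
  refine Finset.sum_le_sum fun n hn => ?_
  have := (le_natDegree_of_mem_supp n hn).trans h
  simpa [eval_finsetSum] using Nat.mul_le_mul_left _ this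

theorem natDegree_spreadPoly_le (p : ℕ[X]) : (spreadPoly p).natDegree ≤ p.natDegree := by
  refine natDegree_sum_le_of_forall_le _ _ fun n hn => (natDegree_C_mul_le _ _).trans ?_
  refine natDegree_sum_le_of_forall_le _ _ fun i hi => ?_
  have := le_natDegree_of_mem_supp n hn
  have := Finset.mem_range.1 hi
  rw [natDegree_X_pow]; omega

end Packed

end StackSorting

/-! ### Polynomial lower bounds for functionals -/

namespace StackSorting

open scoped ENNReal
open Polynomial Packed

/-- `a` describes a polynomial that is a lower bound for the functional `c * L`. -/
def LowerBound (c : ℕ) (L : (ℕ → ℝ≥0∞) → ℝ≥0∞) (a : Packed) : Prop :=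
  ∃ p, Rep p a ∧ ∀ φ, Monotone φ → pairing p φ ≤ c * L φ

namespace Packed

theorem rep_zero : Rep 0 zero := ⟨by simp [zero], by simp, by simp⟩

theorem rep_const (c : ℕ) : Rep (C c) (const c) := ⟨by simp [const], by simp [const], by simp⟩

theorem Rep.add {p q : ℕ[X]} {a b : Packed} (h : Rep p a) (h' : Rep q b) :
    Rep (p + q) (a.add b) where
  eval_base := by rw [eval_add, h.eval_base, h'.eval_base]; rfl
  eval_one_le := by rw [eval_add]; exact add_le_add h.eval_one_le h'.eval_one_le
  natDegree_le := (natDegree_add_le _ _).trans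
    ((max_le (Nat.le_add_right _ _) (Nat.le_add_left _ _)).trans
      (add_le_add h.natDegree_le h'.natDegree_le))

theorem Rep.mul {p q : ℕ[X]} {a b : Packed} (h : Rep p a) (h' : Rep q b) :
    Rep (p * q) (a.mul b) where
  eval_base := by rw [eval_mul, h.eval_base, h'.eval_base]; rfl
  eval_one_le := by rw [eval_mul]; exact Nat.mul_le_mul h.eval_one_le h'.eval_one_le
  natDegree_le := natDegree_mul_le.trans (add_le_add h.natDegree_le h'.natDegree_le)

theorem Rep.shift {p : ℕ[X]} {a : Packed} (h : Rep p a) : Rep (X * p) a.shift where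
  eval_base := by rw [eval_mul, eval_X, h.eval_base]; rfl
  eval_one_le := by rw [eval_mul, eval_X, one_mul]; exact h.eval_one_le
  natDegree_le := natDegree_mul_le.trans (by
    have := h.natDegree_le
    rw [natDegree_X, add_comm]; exact Nat.succ_le_succ this)

theorem Rep.scale {p : ℕ[X]} {a : Packed} (h : Rep p a) {u v : ℕ} (huv : u ≤ v) :
    a.scale u v = zero ∨ Rep (scalePoly u v maxDegree p) (a.scale u v) := by
  cases hb : Nat.ble base (Nat.succ a.s) with
  | true => left; simp [Packed.scale, hb]
  | false =>
    right
    have hs : p.eval 1 < base.pred := by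
      have h1 : ¬ base ≤ a.s + 1 := fun hle => by
        rw [Nat.ble_eq_true_of_le hle] at hb; cases hb
      have h2 := h.eval_one_le
      have h3 : base.pred + 1 = base := Nat.succ_pred (by norm_num [base])
      omega
    have e := eval_scalePoly u v maxDegree p hs
    rw [h.eval_base] at e
    have e1 := eval_one_scalePoly_le huv maxDegree p
    simp only [Packed.scale, hb, force_eq]
    generalize maxDegree = n at *
    refine ⟨e, ?_, natDegree_scalePoly_le _ _ _ _⟩
    change _ ≤ scaleDigits u v n a.N % base.pred
    rw [← e, eval_base_mod, Nat.mod_eq_of_lt (e1.trans_lt hs)]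

theorem Rep.spread {p : ℕ[X]} {a : Packed} (h : Rep p a) :
    a.spread = zero ∨ Rep (X * spreadPoly p) a.spread := by
  cases hb : Nat.ble base (Nat.succ a.s) with
  | true => left; simp [Packed.spread, hb]
  | false =>
    right
    have h3 : base.pred + 1 = base := Nat.succ_pred (by norm_num [base])
    have hs : p.eval 1 < base.pred := by
      have h1 : ¬ base ≤ a.s + 1 := fun hle => by
        rw [Nat.ble_eq_true_of_le hle] at hb; cases hb
      have h2 := h.eval_one_le
      omega
    simp only [Packed.spread, hb]
    refine ⟨?_, ?_, ?_⟩
    · change _ = base * (a.N / base.pred)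
      rw [← h.eval_base, eval_eq_spreadPoly p, Nat.add_mul_div_left _ _ (by omega),
        Nat.div_eq_of_lt hs, zero_add, eval_mul, eval_X]
    · rw [eval_mul, eval_X, one_mul]
      exact (eval_one_spreadPoly_le p h.natDegree_le).trans
        (Nat.mul_le_mul_right _ h.eval_one_le)
    · refine natDegree_mul_le.trans ?_
      have := natDegree_spreadPoly_le p
      have := h.natDegree_le
      rw [natDegree_X]; change _ ≤ a.d + 1; omega

end Packed

namespace LowerBound

variable {c c' : ℕ} {L L' : (ℕ → ℝ≥0∞) → ℝ≥0∞} {a b : Packed}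

theorem weaken (h : LowerBound c L a) (hL : ∀ φ, Monotone φ → c * L φ ≤ c' * L' φ) :
    LowerBound c' L' a :=
  let ⟨p, hp, h⟩ := h
  ⟨p, hp, fun φ hφ => (h φ hφ).trans (hL φ hφ)⟩

theorem zero : LowerBound c L zero := ⟨0, rep_zero, fun φ _ => by simp [pairing_zero]⟩

theorem const : LowerBound c (fun φ => φ 0) (const c) :=
  ⟨C c, rep_const c, fun φ _ => by rw [pairing_C]⟩

theorem of_rep {p : ℕ[X]} (h : Rep p a) : LowerBound 1 (pairing p) a :=
  ⟨p, h, fun φ _ => by simp⟩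

theorem add (h : LowerBound c L a) (h' : LowerBound c L' b) :
    LowerBound c (fun φ => L φ + L' φ) (a.add b) := by
  obtain ⟨p, hp, h⟩ := h
  obtain ⟨q, hq, h'⟩ := h'
  refine ⟨p + q, hp.add hq, fun φ hφ => ?_⟩
  rw [pairing_add, mul_add]
  exact add_le_add (h φ hφ) (h' φ hφ)

/-- Monotonicity of `L'` keeps the inner sum monotone in `i`, as required by the bound for `L`. -/
theorem mul (h : LowerBound c L a) (h' : LowerBound c' L' b)
    (hL' : ∀ {φ ψ : ℕ → ℝ≥0∞}, (∀ n, φ n ≤ ψ n) → L' φ ≤ L' ψ) :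
    LowerBound (c * c') (fun φ => L fun i => L' fun j => φ (i + j)) (a.mul b) := by
  obtain ⟨p, hp, h⟩ := h
  obtain ⟨q, hq, h'⟩ := h'
  refine ⟨p * q, hp.mul hq, fun φ hφ => ?_⟩
  rw [pairing_mul]
  refine (pairing_mono p fun i => h' _ fun x y hxy => hφ (Nat.add_le_add_left hxy i)).trans ?_
  rw [pairing_const_mul]
  push_cast
  rw [mul_comm (c : ℝ≥0∞), mul_assoc]
  refine mul_le_mul_right (h _ fun x y hxy => hL' fun j => ?_) _
  exact hφ (Nat.add_le_add_right hxy j)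

theorem shift (h : LowerBound c L a) : LowerBound c (fun φ => L fun i => φ (i + 1)) a.shift := by
  obtain ⟨p, hp, h⟩ := h
  refine ⟨_, hp.shift, fun φ hφ => ?_⟩
  rw [pairing_X_mul]
  exact h _ fun x y hxy => hφ (Nat.succ_le_succ hxy)

theorem spread (h : LowerBound c L a) :
    LowerBound c (fun φ => L fun i => ∑ s ∈ Finset.range i, φ (s + 1)) a.spread := by
  obtain ⟨p, hp, h⟩ := h
  rcases hp.spread with h0 | h0
  · rw [h0]; exact zero
  refine ⟨_, h0, fun φ hφ => ?_⟩
  rw [pairing_spreadPoly]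
  exact h _ fun x y hxy => Finset.sum_le_sum_of_subset (Finset.range_mono hxy)

theorem scale (h : LowerBound c L a) {u v : ℕ} (huv : u ≤ v) (hv : 0 < v)
    (hL : ∀ φ, (u : ℝ≥0∞) * (c * L φ) ≤ v * (c' * L' φ)) : LowerBound c' L' (a.scale u v) := by
  obtain ⟨p, hp, h⟩ := h
  rcases hp.scale huv with h0 | h0
  · rw [h0]; exact zero
  refine ⟨_, h0, fun φ hφ => ?_⟩
  have := (mul_pairing_scalePoly_le u v maxDegree p hφ).trans
    ((mul_le_mul_right (h φ hφ) _).trans (hL φ))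
  exact (ENNReal.mul_le_mul_iff_right (by exact_mod_cast hv.ne') (ENNReal.natCast_ne_top v)).1 this

theorem sum {l : List Packed} {L : ℕ → (ℕ → ℝ≥0∞) → ℝ≥0∞}
    (h : ∀ k a, l[k]? = some a → LowerBound c (L k) a) :
    LowerBound c (fun φ => ∑' k, L k φ) (sum l) := by
  induction l generalizing L with
  | nil => exact zero
  | cons x l ih =>
    refine ((h 0 x rfl).add (ih fun k a hk => h (k + 1) a (by simpa using hk))).weaken ?_
    intro φ _
    rw [tsum_eq_zero_add' (f := fun k => L k φ) ENNReal.summable]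

end LowerBound

variable (t : ℝ≥0∞)

/-- The `k`-th entry of the list describes a polynomial that bounds the part of `c * D` in which the
rest of the word is one of the words of `restSum t k`. -/
def RestLowerBound (c : ℕ) (D : (ℕ → List Bool → ℝ≥0∞) → ℝ≥0∞) (l : List Packed) : Prop :=
  ∃ p : ℕ → ℕ[X], (∀ k a, l[k]? = some a → Rep (p k) a) ∧ (∀ k, l[k]? = none → p k = 0) ∧
    ∀ Φ : ℕ → List Bool → ℝ≥0∞, (∀ v, Monotone fun i => Φ i v) →
      ∑' k, pairing (p k) (fun i => restSum t k (Φ i)) ≤ c * D Φ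

theorem getElem?_addList (l m : List Packed) (k : ℕ) : (addList l m)[k]? =
    match l[k]?, m[k]? with
    | some x, some y => some (x.add y)
    | some x, none => some x
    | none, y => y := by
  induction l generalizing m k with
  | nil => simp [addList]
  | cons x l ih =>
    cases m with
    | nil =>
      simp only [addList, List.getElem?_nil]
      cases (x :: l)[k]? <;> rfl
    | cons y m =>
      cases k with
      | zero => simp [addList]
      | succ k => simpa [addList] using ih m k

namespace RestLowerBound

variable {t} {c c' : ℕ} {D D' : (ℕ → List Bool → ℝ≥0∞) → ℝ≥0∞} {l m : List Packed}

theorem weaken (h : RestLowerBound t c D l)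
    (hD : ∀ Φ : ℕ → List Bool → ℝ≥0∞, (∀ v, Monotone fun i => Φ i v) → c * D Φ ≤ c' * D' Φ) :
    RestLowerBound t c' D' l :=
  let ⟨p, hp, hp0, h⟩ := h
  ⟨p, hp, hp0, fun Φ hΦ => (h Φ hΦ).trans (hD Φ hΦ)⟩

theorem nil : RestLowerBound t c D [] :=
  ⟨fun _ => 0, by simp, by simp, fun Φ _ => by simp [pairing_zero]⟩

theorem add (h : RestLowerBound t c D l) (h' : RestLowerBound t c D' m) :
    RestLowerBound t c (fun Φ => D Φ + D' Φ) (addList l m) := by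
  obtain ⟨p, hp, hp0, h⟩ := h
  obtain ⟨q, hq, hq0, h'⟩ := h'
  refine ⟨fun k => p k + q k, ?_, ?_, fun Φ hΦ => ?_⟩
  · intro k a ha
    rw [getElem?_addList] at ha
    cases h1 : l[k]? <;> cases h2 : m[k]? <;> simp only [h1, h2] at ha
    · simp at ha
    · simpa [hp0 k h1] using hq k a (h2.trans ha)
    · simpa [hq0 k h2] using hp k a (h1.trans ha)
    · cases ha
      exact (hp k _ h1).add (hq k _ h2)
  · intro k ha
    rw [getElem?_addList] at ha
    cases h1 : l[k]? <;> cases h2 : m[k]? <;> simp [h1, h2] at ha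
    simp [hp0 k h1, hq0 k h2]
  · simp only [pairing_add]
    rw [ENNReal.tsum_add, mul_add]
    exact add_le_add (h Φ hΦ) (h' Φ hΦ)

/-- Appending a block turns `restSum t k` into `restSum t (k + 1)`, which shifts the list by one;
the new head accounts for a mark at the very start. -/
theorem cons (h : RestLowerBound t c D l) :
    RestLowerBound t c (fun Φ => restSum t 0 (Φ 0) + D (appendBlock t Φ)) (const c :: l) := by
  obtain ⟨p, hp, hp0, h⟩ := h
  refine ⟨fun | 0 => C c | k + 1 => p k, ?_, ?_, fun Φ hΦ => ?_⟩
  · rintro (_ | k) a ha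
    · cases ha; exact rep_const c
    · exact hp k a (by simpa using ha)
  · rintro (_ | k) ha
    · cases ha
    · exact hp0 k (by simpa using ha)
  · rw [tsum_eq_zero_add' ENNReal.summable, mul_add, pairing_C]
    refine add_le_add le_rfl (h (appendBlock t Φ) fun v x y hxy => ?_)
    exact (isWeightedSum_blockSum t).mono fun w => hΦ _ hxy

theorem zero_cons (h : RestLowerBound t c D l) :
    RestLowerBound t c (fun Φ => D (appendBlock t Φ)) (zero :: l) := by
  obtain ⟨p, hp, hp0, h⟩ := h
  refine ⟨fun | 0 => 0 | k + 1 => p k, ?_, ?_, fun Φ hΦ => ?_⟩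
  · rintro (_ | k) a ha
    · cases ha; exact rep_zero
    · exact hp k a (by simpa using ha)
  · rintro (_ | k) ha
    · cases ha
    · exact hp0 k (by simpa using ha)
  · rw [tsum_eq_zero_add' ENNReal.summable, pairing_zero, zero_add]
    refine h (appendBlock t Φ) fun v x y hxy => ?_
    exact (isWeightedSum_blockSum t).mono fun w => hΦ _ hxy

theorem mul (h : RestLowerBound t c' D l) {L : (ℕ → ℝ≥0∞) → ℝ≥0∞} {a : Packed}
    (ha : LowerBound c L a)
    (hD : ∀ {Φ Ψ : ℕ → List Bool → ℝ≥0∞}, (∀ i v, Φ i v ≤ Ψ i v) → D Φ ≤ D Ψ) :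
    RestLowerBound t (c * c') (fun Φ => L fun i => D fun j => Φ (i + j)) (mulList a l) := by
  obtain ⟨q, hq, ha⟩ := ha
  obtain ⟨p, hp, hp0, h⟩ := h
  refine ⟨fun k => q * p k, ?_, ?_, fun Φ hΦ => ?_⟩
  · intro k b hb
    rw [mulList, List.getElem?_map, Option.map_eq_some_iff] at hb
    obtain ⟨x, hx, rfl⟩ := hb
    exact hq.mul (hp k x hx)
  · intro k hk
    rw [mulList, List.getElem?_map, Option.map_eq_none_iff] at hk
    simp [hp0 k hk]
  · simp only [pairing_mul]
    rw [← pairing_tsum]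
    refine (pairing_mono q fun i => h (fun j => Φ (i + j)) fun v x y hxy =>
      hΦ v (Nat.add_le_add_left hxy i)).trans ?_
    rw [pairing_const_mul]
    push_cast
    rw [mul_comm (c : ℝ≥0∞), mul_assoc]
    refine mul_le_mul_right (ha _ fun x y hxy => hD fun j v => ?_) _
    exact hΦ v (Nat.add_le_add_right hxy j)

theorem scale (h : RestLowerBound t c D l) {u v : ℕ} (huv : u ≤ v) (hv : 0 < v)
    (hD : ∀ Φ, (u : ℝ≥0∞) * (c * D Φ) ≤ v * (c' * D' Φ)) :
    RestLowerBound t c' D' (scaleList u v l) := by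
  classical
  obtain ⟨p, hp, hp0, h⟩ := h
  -- The zero polynomial replaces entries cut off by `take` and entries where `scale` falls back to
  -- `zero`.
  let P : ℕ → ℕ[X] := fun k =>
    if Rep (scalePoly u v maxDegree (p k)) (((scaleList u v l)[k]?).getD zero) ∧
      (scaleList u v l)[k]? ≠ none then scalePoly u v maxDegree (p k) else 0
  refine ⟨P, ?_, ?_, fun Φ hΦ => ?_⟩
  · intro k a ha
    simp only [P, ha, Option.getD_some]
    split_ifs with hr
    · exact hr.1
    · have ha' := ha
      rw [scaleList, List.getElem?_map, Option.map_eq_some_iff] at ha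
      obtain ⟨x, hx, rfl⟩ := ha
      have hx' : l[k]? = some x := by
        rw [List.getElem?_take] at hx
        split_ifs at hx
        exact hx
      rcases (hp k x hx').scale huv with h0 | h0
      · rw [h0]; exact rep_zero
      · exact (hr ⟨h0, by simp⟩).elim
  · intro k hk
    simp only [P, hk, ne_eq, not_true_eq_false, and_false, if_false]
  · have h1 : v * ∑' k, pairing (P k) (fun i => restSum t k (Φ i)) ≤ v * (c' * D' Φ) := by
      refine le_trans ?_ ((mul_le_mul_right (h Φ hΦ) _).trans (hD Φ))
      rw [← ENNReal.tsum_mul_left, ← ENNReal.tsum_mul_left]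
      refine ENNReal.tsum_le_tsum fun k => ?_
      simp only [P]
      split_ifs
      · exact mul_pairing_scalePoly_le u v maxDegree (p k) fun x y hxy =>
          (isWeightedSum_restSum t k).mono fun w => hΦ w hxy
      · simp [pairing_zero]
    exact (ENNReal.mul_le_mul_iff_right (by exact_mod_cast hv.ne')
      (ENNReal.natCast_ne_top v)).1 h1

theorem sumList {l : List (List Packed)} {D : ℕ → (ℕ → List Bool → ℝ≥0∞) → ℝ≥0∞}
    (h : ∀ k a, l[k]? = some a → RestLowerBound t c (D k) a) :
    RestLowerBound t c (fun Φ => ∑' k, D k Φ) (sumList l) := by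
  induction l generalizing D with
  | nil => exact nil
  | cons x l ih =>
    refine ((h 0 x rfl).add (ih fun k a hk => h (k + 1) a (by simpa using hk))).weaken ?_
    intro Φ _
    rw [tsum_eq_zero_add' (f := fun k => D k Φ) ENNReal.summable]

end RestLowerBound

end StackSorting

/-! ### The certified iteration -/

namespace StackSorting

open scoped ENNReal
open Packed

/-- All bounds are stored as multiples of the inverse of this number. -/
def precision : ℕ := 1000000

/-- Bounds for the functionals `tightSum`, `looseSum` and `blockSum`, applied to functions of the
length of a word, and of their compositions with `markSum`. -/
structure State where
  tight : Packed
  loose : Packed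
  tightMark : List Packed
  looseMark : List Packed
  block : Packed
  blockMark : List Packed

namespace State

/-- A bound for the block that consists of a single letter. -/
def single : Packed :=
  force (Nat.div (Nat.mul 3 (Nat.mul precision precision)) 26) fun c => ⟨Nat.mul base c, c, 1⟩

/-- One round of `blockSum_eq`. A product of two bounds carries the factor `precision ^ 2`, and
`scale` restores a single factor. -/
def nextBlock (p q : Packed) : Packed := (single.add (p.mul q)).scale 1 precision

def nextMark (l : List Packed) (p : Packed) (m : List Packed) : List Packed :=
  scaleList 1 precision (addList (mulList (const precision) (const precision :: l)) (mulList p m))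

/-- Bounds for `restSum`. -/
def rests {α : Type} (q : Packed) (m : List Packed) :
    ℕ → Packed → List Packed → (List Packed → List (List Packed) → α) → α
  | 0, _, _, k => k [] []
  | n + 1, r, d, k => ((r.mul q).scale 1 precision).forcePacked fun r' =>
      forceList (scaleList 1 precision
        (addList (zero :: mulList (const precision) d) (mulList r m))) fun d' =>
      rests q m n r' d' fun R D => k (r :: R) (d :: D)

/-- The fraction `3 / 26` is the factor `t` of the new node. The term with `e` belongs to the mark
at the end of the word, the sum to the marks inside. -/
def insertion (e : Packed) (h R : List Packed) : Packed :=
  (((const precision).mul e).add (sum (List.zipWith mul h R))).scale 3 (Nat.mul 26 precision)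

def insertionMark (h : List Packed) (D : List (List Packed)) : List Packed :=
  scaleList 3 (Nat.mul 26 precision) (sumList (List.zipWith mulList h D))

/-- Improve the bounds. -/
def step {α : Type} (s : State) (k : State → α) : α :=
  (s.tight.add s.loose).forcePacked fun p =>
  forceList (addList s.tightMark s.looseMark) fun l =>
  (nextBlock p s.block).forcePacked fun q =>
  -- A second round with the same bound for the pieces lets the inner recursion progress faster.
  (nextBlock p q).forcePacked fun q =>
  forceList (nextMark l p s.blockMark) fun m =>
  forceList (nextMark l p m) fun m =>
  (nextBlock s.tight q).forcePacked fun r =>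
  forceList (nextMark s.tightMark s.tight m) fun d =>
  rests q m maxLength r d fun R D =>
  forceList (sumList D) fun M =>
  ((const precision).add (sum R)).forcePacked fun e =>
  forceList (M.map shift) fun h =>
  forceList (M.map spread) fun g =>
  (insertion e.shift h R).forcePacked fun p0 =>
  (insertion e.spread g R).forcePacked fun p1 =>
  forceList (insertionMark h D) fun d0 =>
  forceList (insertionMark g D) fun d1 =>
  k ⟨p0, p1, d0, d1, q, m⟩

def initial : State := ⟨zero, zero, [], [], zero, []⟩

/-- The bound for `pieceSum`, applied to the constant function `1`. -/
def total (s : State) : ℕ :=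
  Nat.add (Nat.mod s.tight.N (Nat.pred base)) (Nat.mod s.loose.N (Nat.pred base))

def iterate : ℕ → State → ℕ
  | 0, s => s.total
  | n + 1, s => s.step (iterate n)

end State

/-- A functional on functions of the length. -/
def onLength (F : (List Bool → ℝ≥0∞) → ℝ≥0∞) (φ : ℕ → ℝ≥0∞) : ℝ≥0∞ := F fun w => φ w.length

/-- A functional, composed with `markSum`. -/
noncomputable def onMarks (F : (List Bool → ℝ≥0∞) → ℝ≥0∞) (Φ : ℕ → List Bool → ℝ≥0∞) : ℝ≥0∞ :=
  F fun w => markSum w Φ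

theorem markSum_mono (w : List Bool) {Φ Ψ : ℕ → List Bool → ℝ≥0∞} (h : ∀ i v, Φ i v ≤ Ψ i v) :
    markSum w Φ ≤ markSum w Ψ := by
  induction w generalizing Φ Ψ with
  | nil => exact le_rfl
  | cons b w ih =>
    refine add_le_add ?_ (ih fun i v => h (i + 1) v)
    split_ifs
    · exact h 0 _
    · exact le_rfl

namespace IsWeightedSum

variable {F : (List Bool → ℝ≥0∞) → ℝ≥0∞}

theorem onLength_mono (hF : IsWeightedSum F) {φ ψ : ℕ → ℝ≥0∞} (h : ∀ n, φ n ≤ ψ n) :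
    onLength F φ ≤ onLength F ψ := hF.mono fun _ => h _

theorem onMarks_mono (hF : IsWeightedSum F) {Φ Ψ : ℕ → List Bool → ℝ≥0∞}
    (h : ∀ i v, Φ i v ≤ Ψ i v) : onMarks F Φ ≤ onMarks F Ψ :=
  hF.mono fun w => markSum_mono w h

end IsWeightedSum

/-- `op` is the operation on polynomials that belongs to the operation `G` on functions. -/
structure IsInsertion (op : Packed → Packed) (G : (ℕ → ℝ≥0∞) → ℕ → ℝ≥0∞) : Prop where
  lowerBound : ∀ {c L a}, LowerBound c L a → LowerBound c (fun φ => L (G φ)) (op a)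
  monotone : ∀ {φ}, Monotone φ → Monotone (G φ)
  mono : ∀ {φ ψ}, (∀ n, φ n ≤ ψ n) → ∀ i, G φ i ≤ G ψ i
  comm : ∀ {F}, IsWeightedSum F → ∀ (f : ℕ → List Bool → ℝ≥0∞) i,
    G (fun i => F (f i)) i = F fun v => G (fun i => f i v) i

theorem isInsertion_shift : IsInsertion shift fun φ i => φ (i + 1) where
  lowerBound h := h.shift
  monotone h _ _ hab := h (Nat.succ_le_succ hab)
  mono h _ := h _
  comm _ _ _ := rfl

theorem isInsertion_spread : IsInsertion spread fun φ i => ∑ s ∈ Finset.range i, φ (s + 1) where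
  lowerBound h := h.spread
  monotone _ _ _ hab := Finset.sum_le_sum_of_subset (Finset.range_mono hab)
  mono h _ := Finset.sum_le_sum fun _ _ => h _
  comm hF f i := (hF.finset_sum (Finset.range i) fun s => f (s + 1)).symm

variable {t : ℝ≥0∞}

theorem LowerBound.scale_one {L : (ℕ → ℝ≥0∞) → ℝ≥0∞} {a : Packed}
    (h : LowerBound (precision * precision) L a) :
    LowerBound precision L (a.scale 1 precision) :=
  h.scale (by norm_num [precision]) (by norm_num [precision]) fun φ => by
    push_cast; rw [one_mul, mul_assoc]

theorem RestLowerBound.scale_one {D : (ℕ → List Bool → ℝ≥0∞) → ℝ≥0∞} {l : List Packed}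
    (h : RestLowerBound t (precision * precision) D l) :
    RestLowerBound t precision D (scaleList 1 precision l) :=
  h.scale (by norm_num [precision]) (by norm_num [precision]) fun φ => by
    push_cast; rw [one_mul, mul_assoc]

theorem LowerBound.const_mul {c c' : ℕ} {L : (ℕ → ℝ≥0∞) → ℝ≥0∞} {a : Packed}
    (h : LowerBound c L a) (hL : ∀ {φ ψ : ℕ → ℝ≥0∞}, (∀ n, φ n ≤ ψ n) → L φ ≤ L ψ) :
    LowerBound (c' * c) L ((Packed.const c').mul a) :=
  (LowerBound.const.mul h hL).weaken fun φ _ => by simp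

theorem RestLowerBound.const_mul {c c' : ℕ} {D : (ℕ → List Bool → ℝ≥0∞) → ℝ≥0∞} {l : List Packed}
    (h : RestLowerBound t c D l)
    (hD : ∀ {Φ Ψ : ℕ → List Bool → ℝ≥0∞}, (∀ i v, Φ i v ≤ Ψ i v) → D Φ ≤ D Ψ) :
    RestLowerBound t (c' * c) D (mulList (Packed.const c') l) :=
  (h.mul LowerBound.const hD).weaken fun φ _ => by simp

namespace State

theorem lowerBound_single (ht : 26 * t = 3) :
    LowerBound (precision * precision) (fun φ => t * φ 1) single := by
  have e : single = Packed.shift (Packed.const (3 * (precision * precision) / 26)) := by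
    rw [single, force_eq]; rfl
  rw [e]
  generalize precision * precision = c
  refine LowerBound.const.shift.weaken fun φ _ => ?_
  simp only [zero_add]
  rw [← mul_assoc _ t]
  refine mul_le_mul_left ?_ _
  refine (ENNReal.mul_le_mul_iff_right (a := 26) (by simp) (by simp)).1 ?_
  rw [mul_left_comm, ht]
  norm_cast
  rw [mul_comm c]
  exact Nat.mul_div_le _ _

theorem lowerBound_nextBlock (ht : 26 * t = 3) {F G : (List Bool → ℝ≥0∞) → ℝ≥0∞}
    (hG : ∀ φ, G φ = t * φ [true] + F fun u => blockSum t fun v => φ (u ++ v)) {p q : Packed}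
    (hp : LowerBound precision (onLength F) p)
    (hq : LowerBound precision (onLength (blockSum t)) q) :
    LowerBound precision (onLength G) (nextBlock p q) := by
  refine LowerBound.scale_one (((lowerBound_single ht).add
    (hp.mul hq (isWeightedSum_blockSum t).onLength_mono)).weaken fun φ _ => le_of_eq ?_)
  simp [onLength, hG]

theorem restLowerBound_nextMark {F G : (List Bool → ℝ≥0∞) → ℝ≥0∞}
    {E : (ℕ → List Bool → ℝ≥0∞) → ℝ≥0∞}
    (hE : ∀ {Φ Ψ : ℕ → List Bool → ℝ≥0∞}, (∀ i v, Φ i v ≤ Ψ i v) → E Φ ≤ E Ψ)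
    (hG : ∀ Φ, onMarks G Φ = restSum t 0 (Φ 0) + E (appendBlock t Φ) +
      F fun u => blockSum t fun v => markSum v fun i x => Φ (u.length + i) x)
    {l m : List Packed} {p : Packed} (hl : RestLowerBound t precision E l)
    (hp : LowerBound precision (onLength F) p)
    (hm : RestLowerBound t precision (onMarks (blockSum t)) m) :
    RestLowerBound t precision (onMarks G) (nextMark l p m) := by
  refine RestLowerBound.scale_one ((((hl.cons).const_mul ?_).add
    (hm.mul hp (isWeightedSum_blockSum t).onMarks_mono)).weaken fun Φ _ => le_of_eq ?_)
  · intro Φ Ψ h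
    exact add_le_add ((isWeightedSum_restSum t 0).mono (h 0))
      (hE fun i v => (isWeightedSum_blockSum t).mono fun x => h i _)
  · rw [hG]; rfl

/-- As `rests` passes its lists to a continuation, correctness is stated for any property `P` of the
final value. -/
theorem rests_induction {q : Packed} {m : List Packed}
    (hq : LowerBound precision (onLength (blockSum t)) q)
    (hm : RestLowerBound t precision (onMarks (blockSum t)) m) {α : Type} {P : α → Prop} (n : ℕ) :
    ∀ {k : ℕ} {r : Packed} {d : List Packed} {f : List Packed → List (List Packed) → α},
    LowerBound precision (onLength (restSum t k)) r →
    RestLowerBound t precision (onMarks (restSum t k)) d →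
    (∀ R D, (∀ j a, R[j]? = some a → LowerBound precision (onLength (restSum t (k + j))) a) →
      (∀ j a, D[j]? = some a → RestLowerBound t precision (onMarks (restSum t (k + j))) a) →
      P (f R D)) → P (rests q m n r d f) := by
  induction n with
  | zero => intro k r d f _ _ h; exact h [] [] (by simp) (by simp)
  | succ n ih =>
    intro k r d f hr hd h
    simp only [rests, forcePacked_eq, forceList_eq]
    refine ih (k := k + 1) ?_ ?_ fun R D hR hD => h _ _ ?_ ?_
    · refine LowerBound.scale_one ((hr.mul hq
        (isWeightedSum_blockSum t).onLength_mono).weaken fun φ _ => le_of_eq ?_)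
      simp [onLength, restSum]
    · refine RestLowerBound.scale_one (((hd.const_mul
        (isWeightedSum_restSum t k).onMarks_mono).zero_cons.add
        (hm.mul hr (isWeightedSum_blockSum t).onMarks_mono)).weaken fun Φ _ => le_of_eq ?_)
      rw [onMarks, onMarks, restSum_succ_markSum]; rfl
    · rintro (_ | j) a ha
      · cases ha; exact hr
      · rw [show k + (j + 1) = k + 1 + j by omega]; exact hR j a (by simpa using ha)
    · rintro (_ | j) a ha
      · cases ha; exact hd
      · rw [show k + (j + 1) = k + 1 + j by omega]; exact hD j a (by simpa using ha)

theorem tsum_restSum_le_validSum (φ : List Bool → ℝ≥0∞) :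
    φ [] + ∑' k, restSum t k φ ≤ validSum t φ := by
  refine le_trans (add_le_add le_rfl ?_) (add_treeSum_le_validSum t φ)
  rw [ENNReal.tsum_eq_iSup_nat]
  exact iSup_le fun n => sum_restSum_le_treeSum t n φ

/-- A mark splits a word into a prefix, whose length is recorded by the polynomials of `M`, and a
rest from `restSum t k`, whose length is bounded by `R`. Multiplying polynomials adds the lengths,
after `op` has changed the prefix into the inserted letters. -/
theorem lowerBound_insertion (ht : 26 * t = 3) {op : Packed → Packed}
    {G : (ℕ → ℝ≥0∞) → ℕ → ℝ≥0∞} (hG : IsInsertion op G) {e : Packed} {M R : List Packed}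
    (he : LowerBound precision (onLength (validSum t)) e)
    (hM : RestLowerBound t precision (onMarks (validSum t)) M)
    (hR : ∀ k a, R[k]? = some a → LowerBound precision (onLength (restSum t k)) a) :
    LowerBound precision (fun φ => t * validSum t fun w => endMarkSum w fun i v =>
      G (fun i => φ (i + v.length)) i) (insertion (op e) (M.map op) R) := by
  have h1 : LowerBound (precision * precision) (fun φ => validSum t fun w => G φ w.length)
      ((Packed.const precision).mul (op e)) :=
    (hG.lowerBound he).const_mul fun h => (isWeightedSum_validSum t).mono fun w => hG.mono h _
  have h2 : LowerBound (precision * precision) (fun φ => validSum t fun w => markSum w fun i v =>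
      G (fun i => φ (i + v.length)) i) (sum (List.zipWith mul (M.map op) R)) := by
    obtain ⟨p, hp, hp0, hM⟩ := hM
    have := LowerBound.sum (c := 1 * precision) (l := List.zipWith mul (M.map op) R)
      (L := fun k φ => pairing (p k)
        (G fun i => onLength (restSum t k) fun j => φ (i + j))) ?_
    · refine this.weaken fun φ hφ => ?_
      have h := hM (fun i v => G (fun i => φ (i + v.length)) i) fun v => hG.monotone
        fun x y hxy => hφ (Nat.add_le_add_right hxy _)
      rw [one_mul]
      push_cast
      rw [mul_assoc]
      refine mul_le_mul_right (le_trans (le_of_eq ?_) h) _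
      congr 1
      funext k
      congr 1
      funext i
      exact hG.comm (isWeightedSum_restSum t k) _ _
    · intro k a ha
      rw [List.getElem?_zipWith_eq_some] at ha
      obtain ⟨x, y, hx, hy, rfl⟩ := ha
      rw [List.getElem?_map, Option.map_eq_some_iff] at hx
      obtain ⟨x, hx, rfl⟩ := hx
      exact (hG.lowerBound (LowerBound.of_rep (hp k x hx))).mul (hR k y hy)
        (isWeightedSum_restSum t k).onLength_mono
  refine (h1.add h2).scale (by norm_num [precision]) (by norm_num [precision]) fun φ => ?_
  rw [← (isWeightedSum_validSum t).add]
  have e : ∀ w : List Bool, G φ w.length + (markSum w fun i v =>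
      G (fun i => φ (i + v.length)) i) = endMarkSum w fun i v => G (fun i => φ (i + v.length)) i :=
    fun w => by rw [add_comm]; rfl
  simp only [e]
  refine le_of_eq ?_
  change _ = ((26 * precision : ℕ) : ℝ≥0∞) * _
  push_cast
  rw [← ht]
  ring

/-- Only the marks inside the word are used: after the mark at the end nothing remains that could
carry a further mark. -/
theorem restLowerBound_insertionMark (ht : 26 * t = 3) {op : Packed → Packed}
    {G : (ℕ → ℝ≥0∞) → ℕ → ℝ≥0∞} (hG : IsInsertion op G) {M : List Packed} {D : List (List Packed)}
    (hM : RestLowerBound t precision (onMarks (validSum t)) M)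
    (hD : ∀ k a, D[k]? = some a → RestLowerBound t precision (onMarks (restSum t k)) a) :
    RestLowerBound t precision (fun Φ => t * validSum t fun w => endMarkSum w fun i v =>
      G (fun i => markSum v fun j x => Φ (i + j) x) i) (insertionMark (M.map op) D) := by
  have h2 : RestLowerBound t (precision * precision) (fun Φ => validSum t fun w =>
      endMarkSum w fun i v => G (fun i => markSum v fun j x => Φ (i + j) x) i)
      (sumList (List.zipWith mulList (M.map op) D)) := by
    obtain ⟨p, hp, hp0, hM⟩ := hM
    have := RestLowerBound.sumList (t := t) (c := 1 * precision)
      (l := List.zipWith mulList (M.map op) D) (D := fun k Φ => pairing (p k)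
        (G fun i => onMarks (restSum t k) fun j => Φ (i + j))) ?_
    · refine this.weaken fun Φ hΦ => ?_
      have h := hM (fun i v => G (fun i => markSum v fun j x => Φ (i + j) x) i) fun v =>
        hG.monotone fun x y hxy => markSum_mono v fun j u => hΦ u (Nat.add_le_add_right hxy _)
      rw [one_mul]
      push_cast
      rw [mul_assoc]
      refine mul_le_mul_right (le_trans (le_of_eq ?_)
        (h.trans (mul_le_mul_right ?_ _))) _
      · congr 1
        funext k
        congr 1
        funext i
        exact hG.comm (isWeightedSum_restSum t k) _ _
      · exact (isWeightedSum_validSum t).mono fun w => le_self_add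
    · intro k a ha
      rw [List.getElem?_zipWith_eq_some] at ha
      obtain ⟨x, y, hx, hy, rfl⟩ := ha
      rw [List.getElem?_map, Option.map_eq_some_iff] at hx
      obtain ⟨x, hx, rfl⟩ := hx
      exact (hD k y hy).mul (hG.lowerBound (LowerBound.of_rep (hp k x hx)))
        (isWeightedSum_restSum t k).onMarks_mono
  refine h2.scale (by norm_num [precision]) (by norm_num [precision]) fun Φ => le_of_eq ?_
  change _ = ((26 * precision : ℕ) : ℝ≥0∞) * _
  push_cast
  rw [← ht]
  ring

/-- The bounds are correct. -/
structure Correct (t : ℝ≥0∞) (s : State) : Prop where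
  tight : LowerBound precision (onLength (tightSum t)) s.tight
  loose : LowerBound precision (onLength (looseSum t)) s.loose
  tightMark : RestLowerBound t precision (tightMarkSum t) s.tightMark
  looseMark : RestLowerBound t precision (looseMarkSum t) s.looseMark
  block : LowerBound precision (onLength (blockSum t)) s.block
  blockMark : RestLowerBound t precision (onMarks (blockSum t)) s.blockMark

theorem correct_initial : Correct t initial :=
  ⟨.zero, .zero, .nil, .nil, .zero, .nil⟩

theorem tightMarkSum_mono {Φ Ψ : ℕ → List Bool → ℝ≥0∞} (h : ∀ i v, Φ i v ≤ Ψ i v) :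
    tightMarkSum t Φ ≤ tightMarkSum t Ψ :=
  mul_le_mul_right ((isWeightedSum_validSum t).mono fun w => add_le_add
    (markSum_mono w fun _ v => markSum_mono v fun _ _ => h _ _)
    (markSum_mono [] fun _ _ => h _ _)) _

theorem looseMarkSum_mono {Φ Ψ : ℕ → List Bool → ℝ≥0∞} (h : ∀ i v, Φ i v ≤ Ψ i v) :
    looseMarkSum t Φ ≤ looseMarkSum t Ψ :=
  mul_le_mul_right ((isWeightedSum_validSum t).mono fun w => add_le_add
    (markSum_mono w fun _ v => Finset.sum_le_sum fun _ _ => markSum_mono v fun _ _ => h _ _)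
    (Finset.sum_le_sum fun _ _ => markSum_mono [] fun _ _ => h _ _)) _

/-- Every update replaces known lower bounds in an identity or inequality whose terms are all
nonnegative, so correctness is inherited. -/
theorem Correct.step (ht : 26 * t = 3) {s : State} (hs : Correct t s) {α : Type} {P : α → Prop}
    {k : State → α} (h : ∀ s', Correct t s' → P (k s')) : P (s.step k) := by
  simp only [State.step, forcePacked_eq, forceList_eq]
  have hp : LowerBound precision (onLength (pieceSum t)) (s.tight.add s.loose) :=
    hs.tight.add hs.loose
  have hl := hs.tightMark.add hs.looseMark
  have hlm : ∀ {Φ Ψ : ℕ → List Bool → ℝ≥0∞}, (∀ i v, Φ i v ≤ Ψ i v) →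
      tightMarkSum t Φ + looseMarkSum t Φ ≤ tightMarkSum t Ψ + looseMarkSum t Ψ :=
    fun h => add_le_add (tightMarkSum_mono h) (looseMarkSum_mono h)
  have hq := lowerBound_nextBlock ht (blockSum_eq t) hp
    (lowerBound_nextBlock ht (blockSum_eq t) hp hs.block)
  have hm := restLowerBound_nextMark (G := blockSum t) (F := pieceSum t) hlm (blockSum_markSum t) hl hp
    (restLowerBound_nextMark (G := blockSum t) (F := pieceSum t) hlm (blockSum_markSum t) hl hp hs.blockMark)
  generalize nextBlock (s.tight.add s.loose) (nextBlock (s.tight.add s.loose) s.block) = q at *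
  generalize nextMark _ _ (nextMark _ _ s.blockMark) = m at *
  refine rests_induction hq hm maxLength (k := 0)
    (lowerBound_nextBlock ht (fun φ => rfl) hs.tight hq)
    (restLowerBound_nextMark (G := restSum t 0) (F := tightSum t) tightMarkSum_mono
      (restSum_zero_markSum t) hs.tightMark hs.tight hm)
    fun R D hR hD => h _ ?_
  simp only [zero_add] at hR hD
  have he : LowerBound precision (onLength (validSum t)) ((Packed.const precision).add (sum R)) :=
    (LowerBound.const.add (LowerBound.sum hR)).weaken fun φ _ =>
      mul_le_mul_right (tsum_restSum_le_validSum fun w => φ w.length) _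
  have hM : RestLowerBound t precision (onMarks (validSum t)) (sumList D) :=
    (RestLowerBound.sumList hD).weaken fun Φ _ =>
      mul_le_mul_right (le_trans le_add_self (tsum_restSum_le_validSum fun w => markSum w Φ)) _
  constructor
  · refine (lowerBound_insertion ht isInsertion_shift he hM hR).weaken fun φ _ => le_of_eq ?_
    simp [onLength, tightSum, add_right_comm]
  · refine (lowerBound_insertion ht isInsertion_spread he hM hR).weaken fun φ _ => le_of_eq ?_
    simp [onLength, looseSum]
  · exact restLowerBound_insertionMark ht isInsertion_shift hM hD
  · exact restLowerBound_insertionMark ht isInsertion_spread hM hD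
  · exact hq
  · exact hm

theorem Correct.total_le {s : State} (hs : Correct t s) :
    (s.total : ℝ≥0∞) ≤ precision * pieceSum t fun _ => 1 := by
  obtain ⟨p, hp, h⟩ := hs.tight
  obtain ⟨q, hq, h'⟩ := hs.loose
  have h1 := (pairing_one_mod_le p hp).trans (h _ monotone_const)
  have h2 := (pairing_one_mod_le q hq).trans (h' _ monotone_const)
  rw [pieceSum, mul_add]
  refine le_trans (le_of_eq ?_) (add_le_add h1 h2)
  exact Nat.cast_add _ _

theorem Correct.iterate_le (ht : 26 * t = 3) (n : ℕ) {s : State} (hs : Correct t s) :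
    (iterate n s : ℝ≥0∞) ≤ precision * pieceSum t fun _ => 1 := by
  induction n generalizing s with
  | zero => exact hs.total_le
  | succ n ih => exact hs.step ht (P := fun x : ℕ => (x : ℝ≥0∞) ≤ _) fun s' hs' => ih hs'

set_option maxRecDepth 100000 in
-- After 41 rounds the bound for the total weight of the pieces at `t = 3 / 26` has reached 1, that
-- is, `precision` in the stored scale.
theorem precision_le_iterate : Nat.ble precision (iterate 41 initial) = true := by decide +kernel

theorem one_le_pieceSum (ht : 26 * t = 3) : 1 ≤ pieceSum t fun _ => 1 := by
  have h1 : (precision : ℝ≥0∞) ≤ (iterate 41 initial : ℕ) := by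
    exact_mod_cast Nat.le_of_ble_eq_true precision_le_iterate
  have h2 := h1.trans (correct_initial.iterate_le ht 41)
  refine (ENNReal.mul_le_mul_iff_right (a := (precision : ℝ≥0∞)) ?_
    (ENNReal.natCast_ne_top _)).1 (by rwa [mul_one])
  norm_num [precision]

end State

end StackSorting

/-! ### From divergence to the growth rate -/

namespace StackSorting

open scoped ENNReal

theorem treeSum_one_le (t : ℝ≥0∞) : treeSum t (fun _ => 1) ≤ ∑' n, (W 3 n : ℝ≥0∞) * t ^ n := by
  let β : ℕ → Type := fun n => {π ∈ permutationWords n | IsStackSortable 3 π}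
  let f : {x : GluingTree // x.Valid ∧ x ≠ .nil} → Σ n, β n := fun x =>
    ⟨x.1.size, x.1.perm, x.2.1.sound.perm, x.2.1.sound.sortable⟩
  have hf : Function.Injective f := by
    intro x y h
    have h2 : ∀ p q : Σ n, β n, p = q → p.2.1 = q.2.1 := by rintro p _ rfl; rfl
    exact Subtype.ext (GluingTree.perm_inj x.2.1 y.2.1 (h2 _ _ h))
  have h := ENNReal.tsum_comp_le_tsum_of_injective hf fun p => t ^ p.1
  refine le_trans (le_of_eq ?_) (h.trans (le_of_eq ?_))
  · simp [treeSum, f]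
  · rw [ENNReal.tsum_sigma' fun p : Σ n, β n => t ^ p.1]
    congr 1
    funext n
    have : Finite (β n) := (finite_sortable 3 n).to_subtype
    have := Fintype.ofFinite (β n)
    rw [tsum_fintype]
    change ∑ _b : β n, t ^ n = _
    rw [Finset.sum_const, Finset.card_univ, nsmul_eq_mul, W,
      ← Nat.card_coe_set_eq, ← Nat.card_eq_fintype_card]

/-- If `L * t < 1`, the series over trees would be dominated by a convergent geometric series. -/
theorem growth_rate_ge {L t : ℝ} (ht : 0 < t) (hL : 0 < L) (hW : ∀ n, (W 3 n : ℝ) ≤ L ^ n)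
    (h : treeSum (ENNReal.ofReal t) (fun _ => 1) = ⊤) : 1 / t ≤ L := by
  by_contra hlt
  push Not at hlt
  have h1 : L * t < 1 := by rwa [lt_div_iff₀ ht] at hlt
  have h2 := treeSum_one_le (ENNReal.ofReal t)
  rw [h, top_le_iff] at h2
  have h3 : ∑' n, (W 3 n : ℝ≥0∞) * ENNReal.ofReal t ^ n ≤ ∑' n, ENNReal.ofReal (L * t) ^ n := by
    refine ENNReal.tsum_le_tsum fun n => ?_
    rw [ENNReal.ofReal_mul hL.le, mul_pow]
    gcongr
    rw [← ENNReal.ofReal_pow hL.le, ← ENNReal.ofReal_natCast]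
    exact ENNReal.ofReal_le_ofReal (hW n)
  rw [h2, ENNReal.tsum_geometric, top_le_iff, ENNReal.inv_eq_top, tsub_eq_zero_iff_le] at h3
  exact absurd (ENNReal.ofReal_lt_one.2 h1) (not_lt.2 h3)

end StackSorting

theorem theorem11 :
    ∃ L : ℝ, Tendsto (fun n : ℕ => (StackSorting.W 3 n : ℝ) ^ (1 / (n : ℝ))) atTop (𝓝 L) ∧
      (8.659702 : ℝ) ≤ L := by
  obtain ⟨L, h0, hL, hW⟩ := StackSorting.exists_growth_rate
  refine ⟨L, hL, ?_⟩
  have ht : 26 * ENNReal.ofReal (3 / 26) = 3 := by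
    rw [← ENNReal.ofReal_ofNat 26, ← ENNReal.ofReal_mul (by norm_num)]
    norm_num
  have h := StackSorting.growth_rate_ge (t := 3 / 26) (by norm_num) h0 hW
    (StackSorting.treeSum_eq_top _ (by norm_num) (StackSorting.State.one_le_pieceSum ht))
  -- The bound obtained is 26/3 = 8.666…, slightly more than required.
  exact le_trans (by norm_num) h
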